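/- Let $G$ be a compact topological group carrying a $\sigma$-algebra for which multiplication $G\times G\to G$ and inversion are measurable (the Borel $\sigma$-algebra if $G$ is second countable, for instance if $G$ is Polish; the Baire $\sigma$-algebra for a general compact Hausdorff group), and let $\mu$ be the Haar probability measure on $G$. Let $Z\sim\mu$. Let $d\ge 1$, let $\mathbb{H}^d$ be the space of $d\times d$ complex Hermitian matrices, let $\|\cdot\|$ be the operator norm induced by the Euclidean norm, and let $\lambda_{\max}$ be the largest eigenvalue. Let $\Psi:G\to\mathbb{H}^d$ be a measurable function with $\mathbb{E}\,\Psi(Z)=0$ and $\|\Psi(z)\|\le R$ for all $z\in G$. Let $Y,Y_1,Y_2,\dots$ be i.i.d. random variables in $G$ such that $$Y\sim Y^{-1}\qquad\text{and}\qquad zYz^{-1}\sim Y\quad\text{for all } z\in G.$$ Let $S\ge 0$ be given by $$S^2=\sup_{g\in G}\big\|\mathbb{E}\big[(\Psi(g)-\Psi(Yg))^2\big]\big\|,$$ which is finite since $\Psi$ is bounded, and assume $S>0$. For $i\ge 0$ let $\mu_i$ be the distribution of the product $Y_i\cdots Y_1$ (so $\mu_0$ is the unit mass at the identity), let $\mathrm{TV}(\nu,\mu)=\sup_A|\nu(A)-\mu(A)|$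 with $A$ ranging over the measurable subsets of $G$, and put $$\sigma^2=\frac{S^2}{2}\sum_{i=0}^{\infty}\min\big\{1,\;4RS^{-1}\,\mathrm{TV}(\mu_i,\mu)\big\}\in[0,\infty].$$ Then, for all $t\ge 0$, $$\mathbb{P}\big(\lambda_{\max}(\Psi(Z))\ge t\big)\le d\cdot e^{-t^2/(2\sigma^2)}.$$ Furthermore, $\lambda_{\max}(\Psi(Z))$ is integrable and $$\mathbb{E}\,\lambda_{\max}(\Psi(Z))\le\sigma\sqrt{2\log d}.$$ (When $\sigma^2=\infty$ we read $e^{-t^2/(2\sigma^2)}=1$ and $\infty\cdot 0=0$.) -/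

import Mathlib

open MeasureTheory ProbabilityTheory
open scoped ENNReal Matrix.Norms.L2Operator

noncomputable section

namespace HaarConcentration

/-- The largest eigenvalue of a Hermitian matrix (used for `0 < d`). -/
def lambdaMax {d : ℕ} {A : Matrix (Fin d) (Fin d) ℂ} (hA : A.IsHermitian) : ℝ :=
  ⨆ i, hA.eigenvalues i

/-- The expectation of a random matrix, computed entry by entry. -/
def expectation {Ω : Type*} [MeasurableSpace Ω] {d : ℕ} (P : Measure Ω)
    (M : Ω → Matrix (Fin d) (Fin d) ℂ) : Matrix (Fin d) (Fin d) ℂ :=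
  Matrix.of fun j k => ∫ ω, M ω j k ∂P

/-- The total variation distance `sup_A |ν A - μ A|` over measurable sets `A`,
used for probability measures. -/
def tvDist {G : Type*} [MeasurableSpace G] (ν μ : Measure G) : ℝ :=
  ⨆ A : {A : Set G // MeasurableSet A}, |ν.real A - μ.real A|

/-- The random walk `walk Y i = Y i * ⋯ * Y 1`; the entry `Y 0` is not used, and
`walk Y 0` is the empty product `1`. -/
def walk {Ω G : Type*} [Group G] (Y : ℕ → Ω → G) : ℕ → Ω → G
  | 0 => fun _ => 1
  | i + 1 => fun ω => Y (i + 1) ω * walk Y i ω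

/-- The parameter `σ² = (S² / 2) * ∑_{i ≥ 0} min {1, 4 R S⁻¹ τ i}`, an element of `[0, ∞]`. -/
def sigmaSq (R S : ℝ) (τ : ℕ → ℝ) : ℝ≥0∞ :=
  ENNReal.ofReal (S ^ 2 / 2) * ∑' i, ENNReal.ofReal (min 1 (4 * R * S⁻¹ * τ i))

end HaarConcentration

end

set_option linter.unusedSectionVars false

namespace HaarConcentration

open Matrix

/-! ### Spectral calculus of Hermitian matrices and trace inequalities -/

section Spectral

variable {n : Type*} [Fintype n] [DecidableEq n]

/-! The method is that of exchangeable pairs, applied to the trace moment generating function `m(θ)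
= E tr exp(θ Ψ(Z))`. It is enough to show `m'(θ) ≤ σ² θ m(θ)` for `θ > 0`: since `m(0) = d`, this
integrates to `m(θ) ≤ d exp(σ² θ² / 2)`, and the matrix Laplace transform turns that into the tail
and the expectation bounds. The case `σ² = ∞` is trivial, except for the expectation when `d = 1`,
where `λ_max` is the trace and has mean zero.

By symmetry of `Y` and invariance of `μ`, the pair `(Z, YZ)` is exchangeable. Let `Ψ_i(z)` be the
mean of `Ψ(Y_i ⋯ Y_1 z)`. As the law of `Y` is conjugation invariant, averaging `Ψ_i` over one
further step gives `Ψ_{i+1}`, so `H = Ψ_0 + ⋯ + Ψ_{k-1}` satisfies the approximate Poisson equation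
`E[H(z) - H(Yz)] = Ψ(z) - Ψ_k(z)` (`potential_sub_integral`). Up to the error `Ψ_k`, `m'(θ)` is then
half of `E tr (H(Z) - H(YZ)) (exp(θΨ(Z)) - exp(θΨ(YZ)))`. The mean value trace inequality
(`re_trace_mul_exp_sub_exp_le`) bounds this by the conditional second moments of the increments of
`Ψ` and of `H`.

The increments of `Ψ` cost `S²`. Those of `Ψ_i` cost at most `S² w_i²` with `w_i = min(1, 4 R S⁻¹
TV(μ_i, μ))`: the bound `S²` survives averaging by Jensen's inequality, and `‖Ψ_i‖ ≤ 2 R TV(μ_i, μ)`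
because `Ψ` has mean zero. Hence those of `H` cost at most `S² (∑ w_i)²`. Balancing the two costs
gives the factor `(S² / 2) ∑ w_i`, and the error vanishes as `k → ∞` when the weights are summable.
-/

theorem sinh_le_mul_cosh {x : ℝ} (hx : 0 ≤ x) : Real.sinh x ≤ x * Real.cosh x := by
  have hmono : MonotoneOn (fun y : ℝ => y * Real.cosh y - Real.sinh y) (Set.Ici 0) := by
    refine monotoneOn_of_deriv_nonneg (convex_Ici 0) (by fun_prop) (by fun_prop) fun y hy => ?_
    have hy0 : 0 < y := by simpa using hy
    have h := ((hasDerivAt_id y).mul (Real.hasDerivAt_cosh y)).sub (Real.hasDerivAt_sinh y)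
    have h' : HasDerivAt (fun y : ℝ => y * Real.cosh y - Real.sinh y) (y * Real.sinh y) y := by
      convert! h using 1
      simp
    rw [h'.deriv]
    exact mul_nonneg hy0.le (Real.sinh_nonneg_iff.2 hy0.le)
  have h := hmono (Set.mem_Ici.2 le_rfl) (Set.mem_Ici.2 hx) hx
  simp at h
  linarith

/-- The trapezoid rule overestimates the increments of the exponential function. -/
theorem abs_exp_sub_exp_le (a b : ℝ) :
    |Real.exp a - Real.exp b| ≤ |a - b| * (Real.exp a + Real.exp b) / 2 := by
  wlog hab : b ≤ a generalizing a b
  · have h := this b a (le_of_not_ge hab)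
    rwa [abs_sub_comm, abs_sub_comm a b, add_comm (Real.exp a)]
  rw [abs_of_nonneg (sub_nonneg.2 (Real.exp_le_exp.2 hab)), abs_of_nonneg (sub_nonneg.2 hab)]
  -- With `x = (a - b) / 2`, the difference of the exponentials is `2 exp((a + b) / 2) sinh x` and
  -- their sum is `2 exp((a + b) / 2) cosh x`.
  have h := sinh_le_mul_cosh (x := (a - b) / 2) (by linarith)
  rw [Real.sinh_eq, Real.cosh_eq] at h
  have ha : Real.exp a = Real.exp ((a + b) / 2) * Real.exp ((a - b) / 2) := by
    rw [← Real.exp_add]; ring_nf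
  have hb : Real.exp b = Real.exp ((a + b) / 2) * Real.exp (-((a - b) / 2)) := by
    rw [← Real.exp_add]; ring_nf
  rw [ha, hb]
  nlinarith [Real.exp_pos ((a + b) / 2)]

/-- The action of a square matrix on Euclidean space. -/
noncomputable abbrev act (A : Matrix n n ℂ) : EuclideanSpace ℂ n →L[ℂ] EuclideanSpace ℂ n :=
  Matrix.toEuclideanCLM (n := n) (𝕜 := ℂ) A

theorem act_mul_apply (A B : Matrix n n ℂ) (v : EuclideanSpace ℂ n) :
    act (A * B) v = act A (act B v) := by
  simp [act]

theorem norm_act_le (A : Matrix n n ℂ) (v : EuclideanSpace ℂ n) : ‖act A v‖ ≤ ‖A‖ * ‖v‖ :=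
  (act A).le_opNorm v

theorem inner_act_left {A : Matrix n n ℂ} (hA : A.IsHermitian) (v w : EuclideanSpace ℂ n) :
    inner ℂ (act A v) w = inner ℂ v (act A w) := by
  have h : star (act A) = act A := by
    rw [act, ← map_star, star_eq_conjTranspose, hA.eq]
  conv_rhs => rw [← h]
  rw [ContinuousLinearMap.star_eq_adjoint, ContinuousLinearMap.adjoint_inner_right]

theorem act_eigenvectorBasis {A : Matrix n n ℂ} (hA : A.IsHermitian) (i : n) :
    act A (hA.eigenvectorBasis i) = (hA.eigenvalues i : ℂ) • hA.eigenvectorBasis i := by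
  ext j
  have h := congrFun (hA.mulVec_eigenvectorBasis i) j
  simpa [act] using h

theorem exp_smul_eq_conj {A : Matrix n n ℂ} (hA : A.IsHermitian) (θ : ℝ) :
    NormedSpace.exp (θ • A) = (hA.eigenvectorUnitary : Matrix n n ℂ) *
      diagonal (fun i => (Real.exp (θ * hA.eigenvalues i) : ℂ)) *
        (star hA.eigenvectorUnitary : Matrix n n ℂ) := by
  have hU : IsUnit (hA.eigenvectorUnitary : Matrix n n ℂ) :=
    (Unitary.toUnits hA.eigenvectorUnitary).isUnit
  have hinv : (hA.eigenvectorUnitary : Matrix n n ℂ)⁻¹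
      = (star hA.eigenvectorUnitary : Matrix n n ℂ) :=
    Matrix.inv_eq_right_inv (Unitary.mul_star_self_of_mem hA.eigenvectorUnitary.2)
  conv_lhs => rw [hA.spectral_theorem, Unitary.conjStarAlgAut_apply, ← smul_mul_assoc,
    ← mul_smul_comm]
  have h := Matrix.exp_conj (hA.eigenvectorUnitary : Matrix n n ℂ)
    (θ • diagonal (fun i => (hA.eigenvalues i : ℂ))) hU
  rw [hinv, ← diagonal_smul, Matrix.exp_diagonal] at h
  rw [← diagonal_smul]
  refine h.trans ?_
  congr 3
  ext i
  rw [Pi.coe_exp, ← Complex.exp_eq_exp_ℂ]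
  simp

theorem act_exp_smul_eigenvectorBasis {A : Matrix n n ℂ} (hA : A.IsHermitian) (θ : ℝ) (i : n) :
    act (NormedSpace.exp (θ • A)) (hA.eigenvectorBasis i)
      = (Real.exp (θ * hA.eigenvalues i) : ℂ) • hA.eigenvectorBasis i := by
  apply WithLp.ofLp_injective
  rw [act, Matrix.ofLp_toEuclideanCLM, exp_smul_eq_conj hA, ← mulVec_mulVec, ← mulVec_mulVec,
    hA.star_eigenvectorUnitary_mulVec, diagonal_mulVec_single, mul_one,
    ← mul_one (Complex.ofReal _), ← smul_eq_mul, Pi.single_smul, mulVec_smul,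
    hA.eigenvectorUnitary_mulVec]
  simp

theorem act_exp_eigenvectorBasis {A : Matrix n n ℂ} (hA : A.IsHermitian) (i : n) :
    act (NormedSpace.exp A) (hA.eigenvectorBasis i)
      = (Real.exp (hA.eigenvalues i) : ℂ) • hA.eigenvectorBasis i := by
  simpa using act_exp_smul_eigenvectorBasis hA 1 i

theorem trace_eq_sum_inner (M : Matrix n n ℂ) (b : OrthonormalBasis n ℂ (EuclideanSpace ℂ n)) :
    M.trace = ∑ i, inner ℂ (b i) (act M (b i)) := by
  have h := LinearMap.trace_eq_sum_inner (Matrix.toEuclideanLin M) b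
  rw [show Matrix.toEuclideanLin M = Matrix.toLin (PiLp.basisFun 2 ℂ n) (PiLp.basisFun 2 ℂ n) M from
    rfl, Matrix.trace_toLin_eq] at h
  exact h

theorem trace_mul_exp {A : Matrix n n ℂ} (hA : A.IsHermitian) (M : Matrix n n ℂ) :
    (M * NormedSpace.exp A).trace =
      ∑ i, (Real.exp (hA.eigenvalues i) : ℂ) *
        inner ℂ (hA.eigenvectorBasis i) (act M (hA.eigenvectorBasis i)) := by
  rw [trace_eq_sum_inner _ hA.eigenvectorBasis]
  refine Finset.sum_congr rfl fun i _ => ?_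
  rw [act_mul_apply, act_exp_eigenvectorBasis, map_smul, inner_smul_right]

theorem re_trace_exp_smul {A : Matrix n n ℂ} (hA : A.IsHermitian) (θ : ℝ) :
    (NormedSpace.exp (θ • A)).trace.re = ∑ i, Real.exp (θ * hA.eigenvalues i) := by
  rw [trace_eq_sum_inner _ hA.eigenvectorBasis, Complex.re_sum]
  refine Finset.sum_congr rfl fun i _ => ?_
  rw [act_exp_smul_eigenvectorBasis, inner_smul_right, Complex.re_ofReal_mul]
  simp

theorem re_trace_exp {A : Matrix n n ℂ} (hA : A.IsHermitian) :
    (NormedSpace.exp A).trace.re = ∑ i, Real.exp (hA.eigenvalues i) := by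
  simpa using re_trace_exp_smul hA 1

theorem re_trace_sq_mul_exp {A C : Matrix n n ℂ} (hA : A.IsHermitian) (hC : C.IsHermitian) :
    (C ^ 2 * NormedSpace.exp A).trace.re =
      ∑ i, Real.exp (hA.eigenvalues i) * ‖act C (hA.eigenvectorBasis i)‖ ^ 2 := by
  rw [trace_mul_exp hA, Complex.re_sum]
  refine Finset.sum_congr rfl fun i _ => ?_
  rw [Complex.re_ofReal_mul, pow_two, act_mul_apply, ← inner_act_left hC,
    inner_self_eq_norm_sq_to_K]
  norm_cast

/-- If the quadratic form of `M` is at most `c`, then `tr (M e ^ A) ≤ c tr (e ^ A)`. -/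
theorem re_trace_mul_exp_le {A M : Matrix n n ℂ} (hA : A.IsHermitian) {c : ℝ}
    (hM : ∀ v, ‖v‖ = 1 → (inner ℂ v (act M v)).re ≤ c) :
    (M * NormedSpace.exp A).trace.re ≤ c * (NormedSpace.exp A).trace.re := by
  rw [trace_mul_exp hA, re_trace_exp hA, Complex.re_sum, Finset.mul_sum]
  refine Finset.sum_le_sum fun i _ => ?_
  rw [Complex.re_ofReal_mul, mul_comm c]
  exact mul_le_mul_of_nonneg_left (hM _ (hA.eigenvectorBasis.norm_eq_one i)) (Real.exp_pos _).le

theorem re_trace_mul_exp_eq_double_sum {A C : Matrix n n ℂ} (hA : A.IsHermitian)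
    (hC : C.IsHermitian) (b : OrthonormalBasis n ℂ (EuclideanSpace ℂ n)) :
    (C * NormedSpace.exp A).trace.re = ∑ i, ∑ j, Real.exp (hA.eigenvalues i) *
      (inner ℂ (act C (hA.eigenvectorBasis i)) (b j) *
        inner ℂ (b j) (hA.eigenvectorBasis i)).re := by
  rw [trace_mul_exp hA, Complex.re_sum]
  refine Finset.sum_congr rfl fun i _ => ?_
  rw [Complex.re_ofReal_mul, ← inner_act_left hC, ← b.sum_inner_mul_inner, Complex.re_sum,
    Finset.mul_sum]

/-- Parseval in a second basis `b`. With `b` an eigenbasis of another matrix, traces against both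
exponentials become double sums over the same pairs of eigenvectors and can be compared term by
term. -/
theorem re_trace_sq_mul_exp_eq_double_sum {A C : Matrix n n ℂ} (hA : A.IsHermitian)
    (hC : C.IsHermitian) (b : OrthonormalBasis n ℂ (EuclideanSpace ℂ n)) :
    (C ^ 2 * NormedSpace.exp A).trace.re = ∑ i, ∑ j, Real.exp (hA.eigenvalues i) *
      ‖inner ℂ (act C (hA.eigenvectorBasis i)) (b j)‖ ^ 2 := by
  rw [re_trace_sq_mul_exp hA hC]
  refine Finset.sum_congr rfl fun i _ => ?_
  rw [← Finset.mul_sum, ← b.sum_sq_norm_inner_left]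

/-- The mean value trace inequality for the exponential function. -/
theorem re_trace_mul_exp_sub_exp_le {A B C : Matrix n n ℂ} (hA : A.IsHermitian)
    (hB : B.IsHermitian) (hC : C.IsHermitian) {s : ℝ} (hs : 0 < s) :
    (C * NormedSpace.exp A).trace.re - (C * NormedSpace.exp B).trace.re ≤
      (1 / 4) * (s * (((A - B) ^ 2 * NormedSpace.exp A).trace.re
          + ((A - B) ^ 2 * NormedSpace.exp B).trace.re)
        + s⁻¹ * ((C ^ 2 * NormedSpace.exp A).trace.re
          + (C ^ 2 * NormedSpace.exp B).trace.re)) := by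
  have hAB := hA.sub hB
  rw [re_trace_mul_exp_eq_double_sum hA hC hB.eigenvectorBasis,
    re_trace_mul_exp_eq_double_sum hB hC hA.eigenvectorBasis,
    re_trace_sq_mul_exp_eq_double_sum hA hAB hB.eigenvectorBasis,
    re_trace_sq_mul_exp_eq_double_sum hB hAB hA.eigenvectorBasis,
    re_trace_sq_mul_exp_eq_double_sum hA hC hB.eigenvectorBasis,
    re_trace_sq_mul_exp_eq_double_sum hB hC hA.eigenvectorBasis,
    -- The sums coming from `B` are reordered so that `i` always indexes eigenvectors of `A` and `j`
    -- those of `B`.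
    Finset.sum_comm (f := fun j i => Real.exp (hB.eigenvalues j) *
      (inner ℂ (act C (hB.eigenvectorBasis j)) (hA.eigenvectorBasis i) *
        inner ℂ (hA.eigenvectorBasis i) (hB.eigenvectorBasis j)).re),
    Finset.sum_comm (f := fun j i => Real.exp (hB.eigenvalues j) *
      ‖inner ℂ (act (A - B) (hB.eigenvectorBasis j)) (hA.eigenvectorBasis i)‖ ^ 2),
    Finset.sum_comm (f := fun j i => Real.exp (hB.eigenvalues j) *
      ‖inner ℂ (act C (hB.eigenvectorBasis j)) (hA.eigenvectorBasis i)‖ ^ 2)]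
  simp only [← Finset.sum_add_distrib, ← Finset.sum_sub_distrib, Finset.mul_sum]
  refine Finset.sum_le_sum fun i _ => Finset.sum_le_sum fun j _ => ?_
  set u := hA.eigenvectorBasis i
  set v := hB.eigenvectorBasis j
  set a := hA.eigenvalues i
  set b := hB.eigenvalues j
  -- Between an eigenvector of `A` and one of `B`, the difference `A - B` acts as the scalar `a -
  -- b`; this reduces the matrix inequality to the scalar trapezoid bound.
  have h1 : inner ℂ (act (A - B) u) v = ((a - b : ℝ) : ℂ) * inner ℂ u v := by
    have hx : act (A - B) u = act A u - act B u := by simp [act]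
    rw [hx, inner_sub_left, inner_act_left hB, act_eigenvectorBasis, act_eigenvectorBasis,
      inner_smul_left, inner_smul_right]
    simp [a, b, u, v]
    ring
  have h2 : ‖inner ℂ (act (A - B) v) u‖ = ‖inner ℂ (act (A - B) u) v‖ := by
    rw [inner_act_left hAB, norm_inner_symm]
  have h3 : ‖inner ℂ (act C v) u‖ = ‖inner ℂ (act C u) v‖ := by
    rw [inner_act_left hC, norm_inner_symm]
  have h4 : (inner ℂ (act C v) u * inner ℂ u v).re = (inner ℂ (act C u) v * inner ℂ v u).re := by
    rw [inner_act_left hC, ← inner_conj_symm v (act C u), ← inner_conj_symm u v, ← map_mul,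
      Complex.conj_re]
  rw [h2, h3, h4, h1, norm_mul, Complex.norm_real, Real.norm_eq_abs]
  have h5 : |(inner ℂ (act C u) v * inner ℂ v u).re| ≤ ‖inner ℂ (act C u) v‖ * ‖inner ℂ u v‖ := by
    refine (Complex.abs_re_le_norm _).trans_eq ?_
    rw [norm_mul, norm_inner_symm v u]
  set x := ‖inner ℂ (act C u) v‖
  set y := ‖inner ℂ u v‖
  set r := (inner ℂ (act C u) v * inner ℂ v u).re
  have hxy : 0 ≤ x * y := by positivity
  calc Real.exp a * r - Real.exp b * r = (Real.exp a - Real.exp b) * r := by ring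
    _ ≤ |Real.exp a - Real.exp b| * |r| := (le_abs_self _).trans_eq (abs_mul _ _)
    _ ≤ (|a - b| * (Real.exp a + Real.exp b) / 2) * (x * y) :=
      mul_le_mul (abs_exp_sub_exp_le a b) h5 (abs_nonneg _) (by positivity)
    _ = (Real.exp a + Real.exp b) / 2 * ((|a - b| * y) * x) := by ring
    _ ≤ (Real.exp a + Real.exp b) / 2 * ((s * (|a - b| * y) ^ 2 + s⁻¹ * x ^ 2) / 2) := by
      refine mul_le_mul_of_nonneg_left ?_ (by positivity)
      have := sq_nonneg (s * (|a - b| * y) - x)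
      have h6 : s⁻¹ * (s * (|a - b| * y) - x) ^ 2 =
        s * (|a - b| * y) ^ 2 + s⁻¹ * x ^ 2 - 2 * ((|a - b| * y) * x) := by
        field_simp
        ring
      have h7 : 0 ≤ s⁻¹ * (s * (|a - b| * y) - x) ^ 2 := by positivity
      linarith
    _ = _ := by ring

theorem eigenvalues_le_lambdaMax {d : ℕ} {A : Matrix (Fin d) (Fin d) ℂ} (hA : A.IsHermitian)
    (i : Fin d) : hA.eigenvalues i ≤ lambdaMax hA :=
  le_ciSup (Set.finite_range _).bddAbove i

theorem exists_eigenvalues_eq_lambdaMax {d : ℕ} (hd : 0 < d) {A : Matrix (Fin d) (Fin d) ℂ}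
    (hA : A.IsHermitian) : ∃ i, hA.eigenvalues i = lambdaMax hA :=
  haveI : Nonempty (Fin d) := ⟨⟨0, hd⟩⟩
  exists_eq_ciSup_of_finite

theorem abs_lambdaMax_le {d : ℕ} (hd : 0 < d) {A : Matrix (Fin d) (Fin d) ℂ}
    (hA : A.IsHermitian) : |lambdaMax hA| ≤ ‖A‖ := by
  obtain ⟨i, hi⟩ := exists_eigenvalues_eq_lambdaMax hd hA
  have h := norm_act_le A (hA.eigenvectorBasis i)
  rw [act_eigenvectorBasis, norm_smul, hA.eigenvectorBasis.norm_eq_one, mul_one, mul_one,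
    Complex.norm_real, hi] at h
  exact h

theorem exp_mul_lambdaMax_le {d : ℕ} (hd : 0 < d) {A : Matrix (Fin d) (Fin d) ℂ}
    (hA : A.IsHermitian) (θ : ℝ) :
    Real.exp (θ * lambdaMax hA) ≤ (NormedSpace.exp (θ • A)).trace.re := by
  obtain ⟨i, hi⟩ := exists_eigenvalues_eq_lambdaMax hd hA
  rw [re_trace_exp_smul hA, ← hi]
  exact Finset.single_le_sum (f := fun i => Real.exp (θ * hA.eigenvalues i))
    (fun j _ => (Real.exp_pos _).le) (Finset.mem_univ i)

theorem re_trace_exp_smul_le {d : ℕ} {A : Matrix (Fin d) (Fin d) ℂ} (hA : A.IsHermitian)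
    {θ : ℝ} (hθ : 0 ≤ θ) :
    (NormedSpace.exp (θ • A)).trace.re ≤ d * Real.exp (θ * lambdaMax hA) := by
  rw [re_trace_exp_smul hA]
  refine (Finset.sum_le_card_nsmul _ _ (Real.exp (θ * lambdaMax hA)) fun i _ => ?_).trans_eq ?_
  · exact Real.exp_le_exp.2 (mul_le_mul_of_nonneg_left (eigenvalues_le_lambdaMax hA i) hθ)
  · simp

-- Squeeze from `exp(θ λ_max) ≤ tr exp(θ A) ≤ d exp(θ λ_max)`. It exhibits `λ_max` as a pointwise
-- limit of continuous functions of `A`, whence its measurability.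
open Filter Topology in
theorem tendsto_log_re_trace_exp {d : ℕ} (hd : 0 < d) {A : Matrix (Fin d) (Fin d) ℂ}
    (hA : A.IsHermitian) :
    Tendsto (fun k : ℕ => Real.log (NormedSpace.exp (((k : ℝ) + 1) • A)).trace.re / ((k : ℝ) + 1))
      atTop (𝓝 (lambdaMax hA)) := by
  have hlim : Tendsto (fun k : ℕ => Real.log d * (1 / ((k : ℝ) + 1)) + lambdaMax hA) atTop
      (𝓝 (lambdaMax hA)) := by
    simpa using (tendsto_one_div_add_atTop_nhds_zero_nat.const_mul (Real.log d)).add_const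
      (lambdaMax hA)
  refine tendsto_of_tendsto_of_tendsto_of_le_of_le tendsto_const_nhds hlim (fun k => ?_)
    (fun k => ?_)
  · have hk : (0 : ℝ) < k + 1 := by positivity
    dsimp only
    rw [le_div_iff₀ hk, Real.le_log_iff_exp_le, mul_comm]
    · exact exp_mul_lambdaMax_le hd hA _
    · exact (Real.exp_pos _).trans_le (exp_mul_lambdaMax_le hd hA _)
  · have hk : (0 : ℝ) < k + 1 := by positivity
    have hd' : (0 : ℝ) < d := by exact_mod_cast hd
    dsimp only
    rw [div_le_iff₀ hk, add_mul, mul_assoc, one_div_mul_cancel hk.ne', mul_one,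
      mul_comm (lambdaMax hA)]
    refine (Real.log_le_log ((Real.exp_pos _).trans_le (exp_mul_lambdaMax_le hd hA _))
      (re_trace_exp_smul_le hA hk.le)).trans_eq ?_
    rw [Real.log_mul hd'.ne' (Real.exp_pos _).ne', Real.log_exp]

end Spectral

/-! ### Traces and quadratic forms as real-linear functionals -/

section LinearMaps

variable {n : Type*} [Fintype n] [DecidableEq n]

instance : ProperSpace (Matrix n n ℂ) := FiniteDimensional.proper ℂ _

/-- Evaluation of the action of matrices at a fixed vector. -/
noncomputable def actCLM (v : EuclideanSpace ℂ n) : Matrix n n ℂ →L[ℝ] EuclideanSpace ℂ n :=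
  LinearMap.mkContinuous
    { toFun := fun A => act A v
      map_add' := fun A B => by simp [act]
      map_smul' := fun c A => by
        change act (c • A) v = c • act A v
        rw [← Complex.coe_smul c A, act, map_smul]
        exact Complex.coe_smul c _ } ‖v‖ fun A => (norm_act_le A v).trans_eq (mul_comm _ _)

@[simp] theorem actCLM_apply (v : EuclideanSpace ℂ n) (A : Matrix n n ℂ) :
    actCLM v A = act A v := rfl

/-- The real part of the trace as a continuous real-linear map. -/
noncomputable def reTrace : Matrix n n ℂ →L[ℝ] ℝ where
  toFun A := A.trace.re
  map_add' A B := by simp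
  map_smul' c A := by simp [Matrix.trace_smul]
  cont := Complex.continuous_re.comp (continuous_id.matrix_trace)

@[simp] theorem reTrace_apply (A : Matrix n n ℂ) : reTrace A = A.trace.re := rfl

/-- The quadratic form of a matrix at a fixed vector, as a function of the matrix. -/
noncomputable def quadCLM (v : EuclideanSpace ℂ n) : Matrix n n ℂ →L[ℝ] ℝ :=
  Complex.reCLM ∘L ((innerSL ℂ v).restrictScalars ℝ) ∘L actCLM v

@[simp] theorem quadCLM_apply (v : EuclideanSpace ℂ n) (A : Matrix n n ℂ) :
    quadCLM v A = (inner ℂ v (act A v)).re := rfl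

theorem abs_quadCLM_le (v : EuclideanSpace ℂ n) (A : Matrix n n ℂ) :
    |quadCLM v A| ≤ ‖A‖ * ‖v‖ ^ 2 := by
  rw [quadCLM_apply]
  calc |(inner ℂ v (act A v)).re| ≤ ‖v‖ * ‖act A v‖ :=
        (Complex.abs_re_le_norm _).trans (norm_inner_le_norm _ _)
    _ ≤ ‖v‖ * (‖A‖ * ‖v‖) := mul_le_mul_of_nonneg_left (norm_act_le A v) (norm_nonneg v)
    _ = _ := by ring

theorem quadCLM_sq {A : Matrix n n ℂ} (hA : A.IsHermitian) (v : EuclideanSpace ℂ n) :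
    quadCLM v (A ^ 2) = ‖act A v‖ ^ 2 := by
  rw [quadCLM_apply, pow_two, act_mul_apply, ← inner_act_left hA, inner_self_eq_norm_sq_to_K]
  norm_cast

/-- In an eigenbasis the quadratic form reads off the eigenvalues, and these control the norm of a
Hermitian matrix. -/
theorem norm_le_of_abs_quadCLM_le {A : Matrix n n ℂ} (hA : A.IsHermitian) {c : ℝ} (hc : 0 ≤ c)
    (h : ∀ v : EuclideanSpace ℂ n, ‖v‖ = 1 → |quadCLM v A| ≤ c) : ‖A‖ ≤ c := by
  have heig : ∀ i, |hA.eigenvalues i| ≤ c := fun i => by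
    have := h _ (hA.eigenvectorBasis.norm_eq_one i)
    rw [quadCLM_apply, act_eigenvectorBasis, inner_smul_right, Complex.re_ofReal_mul] at this
    simpa using this
  refine ContinuousLinearMap.opNorm_le_bound (act A) hc fun v => ?_
  refine le_of_sq_le_sq ?_ (by positivity)
  rw [mul_pow, ← hA.eigenvectorBasis.sum_sq_norm_inner_right (act A v),
    ← hA.eigenvectorBasis.sum_sq_norm_inner_right v, Finset.mul_sum]
  refine Finset.sum_le_sum fun i _ => ?_
  rw [← inner_act_left hA, act_eigenvectorBasis, inner_smul_left, norm_mul, mul_pow]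
  refine mul_le_mul_of_nonneg_right ?_ (by positivity)
  rw [Complex.conj_ofReal, Complex.norm_real, Real.norm_eq_abs]
  exact pow_le_pow_left₀ (abs_nonneg _) (heig i) 2

end LinearMaps

/-! ### Bounded integrands and total variation -/

section Integrals

theorem integrable_comp_of_bounded {α E F : Type*} [MeasurableSpace α] {P : Measure α}
    [IsFiniteMeasure P] [NormedAddCommGroup E] [ProperSpace E] [NormedAddCommGroup F]
    {X : α → E} (hX : StronglyMeasurable X) {R : ℝ} (hR : ∀ a, ‖X a‖ ≤ R) {f : E → F}
    (hf : Continuous f) : Integrable (fun a => f (X a)) P := by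
  obtain ⟨C, hC⟩ := (isCompact_closedBall (0 : E) R).exists_bound_of_continuousOn hf.continuousOn
  exact Integrable.of_bound (hf.comp_stronglyMeasurable hX).aestronglyMeasurable C
    (Filter.Eventually.of_forall fun a => hC _ (by simpa using hR a))

theorem integrable_of_bounded {α E : Type*} [MeasurableSpace α] {P : Measure α}
    [IsFiniteMeasure P] [NormedAddCommGroup E]
    {X : α → E} (hX : StronglyMeasurable X) {R : ℝ} (hR : ∀ a, ‖X a‖ ≤ R) : Integrable X P :=
  Integrable.of_bound hX.aestronglyMeasurable R (Filter.Eventually.of_forall hR)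

theorem norm_integral_sq_le {α E : Type*} [MeasurableSpace α] {P : Measure α}
    [IsProbabilityMeasure P] [NormedAddCommGroup E] [NormedSpace ℝ E] {f : α → E}
    (hf : Integrable (fun a => ‖f a‖) P) (hf2 : Integrable (fun a => ‖f a‖ ^ 2) P) :
    ‖∫ a, f a ∂P‖ ^ 2 ≤ ∫ a, ‖f a‖ ^ 2 ∂P := by
  have h1 : ‖∫ a, f a ∂P‖ ^ 2 ≤ (∫ a, ‖f a‖ ∂P) ^ 2 :=
    pow_le_pow_left₀ (norm_nonneg _) (norm_integral_le_integral_norm _) 2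
  refine h1.trans ?_
  set c := ∫ a, ‖f a‖ ∂P with hc
  have h2 : 0 ≤ ∫ a, (‖f a‖ ^ 2 - 2 * c * ‖f a‖ + c ^ 2) ∂P :=
    integral_nonneg fun a => (sq_nonneg (‖f a‖ - c)).trans_eq (by ring)
  rw [integral_add (f := fun a => ‖f a‖ ^ 2 - 2 * c * ‖f a‖) (hf2.sub (hf.const_mul _))
      (integrable_const _),
    integral_sub hf2 (hf.const_mul _), integral_const_mul, ← hc] at h2
  simp at h2
  nlinarith

theorem abs_measureReal_sub_le_tvDist {G : Type*} [MeasurableSpace G] (ν μ : Measure G)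
    [IsProbabilityMeasure ν] [IsProbabilityMeasure μ] {A : Set G} (hA : MeasurableSet A) :
    |ν.real A - μ.real A| ≤ tvDist ν μ := by
  refine le_ciSup (f := fun A : {A : Set G // MeasurableSet A} => |ν.real A - μ.real A|)
    ⟨1, ?_⟩ ⟨A, hA⟩
  rintro _ ⟨B, rfl⟩
  have h1 := measureReal_le_one (μ := ν) (s := (B : Set G))
  have h2 := measureReal_le_one (μ := μ) (s := (B : Set G))
  have h3 := measureReal_nonneg (μ := ν) (s := (B : Set G))
  have h4 := measureReal_nonneg (μ := μ) (s := (B : Set G))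
  exact abs_le.2 ⟨by linarith, by linarith⟩

theorem tvDist_nonneg {G : Type*} [MeasurableSpace G] (ν μ : Measure G) : 0 ≤ tvDist ν μ :=
  Real.iSup_nonneg fun _ => abs_nonneg _

/-- Where `ν` dominates `μ`, the nonnegative function `R - f` has the larger integral under `ν`. -/
theorem setIntegral_sub_le {G : Type*} [MeasurableSpace G] {ν μ : Measure G}
    [IsProbabilityMeasure ν] [IsProbabilityMeasure μ] {f : G → ℝ} (hf : StronglyMeasurable f)
    {R : ℝ} (hR : ∀ g, |f g| ≤ R) {A : Set G} (hA : μ.restrict A ≤ ν.restrict A) :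
    ∫ x in A, f x ∂ν - ∫ x in A, f x ∂μ ≤ R * (ν.real A - μ.real A) := by
  have hi : ∀ (κ : Measure G) [IsProbabilityMeasure κ], Integrable f (κ.restrict A) :=
    fun κ _ => integrable_of_bounded hf hR
  have h := integral_mono_measure (f := fun x => R - f x) hA
    (Filter.Eventually.of_forall fun x => sub_nonneg.2 (abs_le.1 (hR x)).2)
    ((integrable_const R).sub (hi ν))
  rw [integral_sub (integrable_const R) (hi ν), integral_sub (integrable_const R) (hi μ)] at h
  simp only [integral_const, measureReal_restrict_apply_univ, smul_eq_mul] at h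
  linarith

theorem integral_sub_le_tvDist {G : Type*} [MeasurableSpace G] {ν μ : Measure G}
    [IsProbabilityMeasure ν] [IsProbabilityMeasure μ] {f : G → ℝ} (hf : StronglyMeasurable f)
    {R : ℝ} (hR0 : 0 ≤ R) (hR : ∀ g, |f g| ≤ R) :
    ∫ x, f x ∂ν - ∫ x, f x ∂μ ≤ 2 * R * tvDist ν μ := by
  obtain ⟨A, hA, h1, h2⟩ := hahn_decomposition ν μ
  have hi : ∀ (κ : Measure G) [IsProbabilityMeasure κ], Integrable f κ :=
    fun κ _ => integrable_of_bounded hf hR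
  have hle1 : μ.restrict A ≤ ν.restrict A := by
    refine Measure.le_iff.2 fun t ht => ?_
    -- On each half of the Hahn decomposition one measure dominates the other. Each half contributes
    -- at most `R * tvDist ν μ`, hence the factor 2.
    rw [Measure.restrict_apply ht, Measure.restrict_apply ht]
    exact h1 _ (ht.inter hA) Set.inter_subset_right
  have hle2 : ν.restrict Aᶜ ≤ μ.restrict Aᶜ := by
    refine Measure.le_iff.2 fun t ht => ?_
    rw [Measure.restrict_apply ht, Measure.restrict_apply ht]
    exact h2 _ (ht.inter hA.compl) Set.inter_subset_right
  have k1 := setIntegral_sub_le hf hR hle1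
  have k2 := setIntegral_sub_le (f := fun x => -f x) hf.neg (fun g => by simpa using hR g) hle2
  rw [integral_neg, integral_neg] at k2
  rw [← integral_add_compl hA (hi ν), ← integral_add_compl hA (hi μ)]
  have t1 := (le_abs_self _).trans (abs_measureReal_sub_le_tvDist ν μ hA)
  have t2 := (neg_le_abs _).trans (abs_measureReal_sub_le_tvDist ν μ hA.compl)
  nlinarith

theorem abs_integral_sub_le_tvDist {G : Type*} [MeasurableSpace G] {ν μ : Measure G}
    [IsProbabilityMeasure ν] [IsProbabilityMeasure μ] {f : G → ℝ} (hf : StronglyMeasurable f)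
    {R : ℝ} (hR0 : 0 ≤ R) (hR : ∀ g, |f g| ≤ R) :
    |∫ x, f x ∂ν - ∫ x, f x ∂μ| ≤ 2 * R * tvDist ν μ := by
  have h1 := integral_sub_le_tvDist (ν := ν) (μ := μ) hf hR0 hR
  have h2 := integral_sub_le_tvDist (ν := ν) (μ := μ) (f := fun x => -f x) hf.neg hR0
    (fun g => by simpa using hR g)
  rw [integral_neg, integral_neg] at h2
  exact abs_le.2 ⟨by linarith, h1⟩

variable {n : Type*} [Fintype n] [DecidableEq n]

theorem isHermitian_integral {α : Type*} [MeasurableSpace α] {P : Measure α}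
    {X : α → Matrix n n ℂ} (hX : ∀ a, (X a).IsHermitian) :
    (∫ a, X a ∂P).IsHermitian := by
  have h := ((starL' ℝ : Matrix n n ℂ ≃L[ℝ] Matrix n n ℂ).integral_comp_comm (μ := P) X)
  rw [IsHermitian, ← star_eq_conjTranspose]
  refine Eq.trans h.symm (integral_congr_ae (Filter.Eventually.of_forall fun a => ?_))
  exact hX a

/-- A bounded Hermitian function with `μ`-mean zero has `ν`-mean controlled by the total
variation distance. -/
theorem norm_integral_le_tvDist {G : Type*} [MeasurableSpace G] {ν μ : Measure G}
    [IsProbabilityMeasure ν] [IsProbabilityMeasure μ] {X : G → Matrix n n ℂ}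
    (hX : StronglyMeasurable X) (hH : ∀ g, (X g).IsHermitian) {R : ℝ} (hR0 : 0 ≤ R)
    (hR : ∀ g, ‖X g‖ ≤ R) (hmean : ∫ g, X g ∂μ = 0) :
    ‖∫ g, X g ∂ν‖ ≤ 2 * R * tvDist ν μ := by
  refine norm_le_of_abs_quadCLM_le (isHermitian_integral hH)
    (mul_nonneg (by positivity) (tvDist_nonneg _ _)) fun v hv => ?_
  have hi : ∀ (κ : Measure G) [IsProbabilityMeasure κ], Integrable X κ :=
    fun κ _ => integrable_of_bounded hX hR
  -- Testing against one unit vector at a time keeps the constant free of the dimension.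
  have h := abs_integral_sub_le_tvDist (ν := ν) (μ := μ)
    ((quadCLM v).continuous.comp_stronglyMeasurable hX) hR0
    (fun g => (abs_quadCLM_le v (X g)).trans (by simpa [hv] using hR g))
  rwa [(quadCLM v).integral_comp_comm (hi ν), (quadCLM v).integral_comp_comm (hi μ), hmean,
    map_zero, sub_zero] at h

theorem stronglyMeasurable_matrix {α : Type*} [MeasurableSpace α] {X : α → Matrix n n ℂ}
    (hX : ∀ j k, Measurable fun a => X a j k) : StronglyMeasurable X := by
  have h : X = fun a => ∑ j, ∑ k, X a j k • Matrix.single j k (1 : ℂ) := by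
    funext a
    conv_lhs => rw [Matrix.matrix_eq_sum_single (X a)]
    simp
  rw [h]
  refine Finset.stronglyMeasurable_fun_sum _ fun j _ => Finset.stronglyMeasurable_fun_sum _ fun k _ => ?_
  exact (hX j k).stronglyMeasurable.smul_const _

theorem expectation_eq_integral {Ω : Type*} [MeasurableSpace Ω] {P : Measure Ω} {d : ℕ}
    {X : Ω → Matrix (Fin d) (Fin d) ℂ} (hX : Integrable X P) :
    expectation P X = ∫ ω, X ω ∂P := by
  ext j k
  let L : Matrix (Fin d) (Fin d) ℂ →L[ℂ] ℂ :=
    ⟨Matrix.entryLinearMap ℂ ℂ j k, continuous_id.matrix_elem j k⟩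
  exact L.integral_comp_comm hX

end Integrals

/-! ### Invariance of Haar measure and the exchangeable pair -/

section Group

variable {G : Type*} [Group G] [MeasurableSpace G] [MeasurableMul₂ G] [MeasurableInv G]

/-- A left-invariant probability measure on a group is right-invariant. -/
theorem isMulRightInvariant_of_isProbabilityMeasure (μ : Measure G) [IsProbabilityMeasure μ]
    [μ.IsMulLeftInvariant] : μ.IsMulRightInvariant := by
  have : IsProbabilityMeasure μ.inv := Measure.isProbabilityMeasure_map measurable_inv.aemeasurable
  -- The measure `μ.inv` is right-invariant. The double integral of `f (x * y)` against `μ.inv` in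
  -- `x` and `μ` in `y` equals the integral of `f` against either measure, according to the order of
  -- integration.
  suffices h : μ.inv = μ by rw [← h]; infer_instance
  refine Measure.ext_of_lintegral _ fun f hf => ?_
  have hf2 : Measurable (Function.uncurry fun y x : G => f (x * y)) :=
    hf.comp (measurable_snd.mul measurable_fst)
  have h1 : ∫⁻ x, ∫⁻ y, f (x * y) ∂μ ∂μ.inv = ∫⁻ y, f y ∂μ := by
    simp [lintegral_mul_left_eq_self]
  have h2 : ∫⁻ y, ∫⁻ x, f (x * y) ∂μ.inv ∂μ = ∫⁻ x, f x ∂μ.inv := by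
    simp [lintegral_mul_right_eq_self]
  rw [← h1, ← h2, lintegral_lintegral_swap hf2.aemeasurable]

/-- If `Z` is distributed as `μ` and `Y` is an independent symmetric step, then `(Z, Y Z)` is
an exchangeable pair. -/
theorem measurePreserving_exchange (μ ρ : Measure G) [IsProbabilityMeasure μ]
    [IsProbabilityMeasure ρ] [μ.IsMulLeftInvariant] (hinv : ρ.map (fun y => y⁻¹) = ρ) :
    MeasurePreserving (fun p : G × G => (p.2 * p.1, p.2⁻¹)) (μ.prod ρ) (μ.prod ρ) := by
  have hm : Measurable (fun p : G × G => (p.2 * p.1, p.2⁻¹)) :=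
    (measurable_snd.mul measurable_fst).prodMk measurable_snd.inv
  refine ⟨hm, Measure.ext_of_lintegral _ fun f hf => ?_⟩
  have hg : Measurable fun y => ∫⁻ x, f (x, y) ∂μ :=
    (hf.comp measurable_swap).lintegral_prod_right'
  rw [lintegral_map hf hm, lintegral_prod_symm' (fun p : G × G => f (p.2 * p.1, p.2⁻¹))
    (hf.comp hm), lintegral_prod_symm' _ hf]
  calc ∫⁻ y, ∫⁻ x, f (y * x, y⁻¹) ∂μ ∂ρ = ∫⁻ y, ∫⁻ x, f (x, y⁻¹) ∂μ ∂ρ :=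
        lintegral_congr fun y => lintegral_mul_left_eq_self (fun x => f (x, y⁻¹)) y
    _ = ∫⁻ y, ∫⁻ x, f (x, y) ∂μ ∂(ρ.map fun y => y⁻¹) := by
        rw [lintegral_map hg measurable_inv]
    _ = _ := by rw [hinv]

end Group

/-- The data of the concentration argument: a bounded Hermitian function `Ψ`, the law `ρ` of the
step of a random walk and the laws `ν i` of the walk after `i` steps. -/
structure WalkData {G : Type*} [Group G] [MeasurableSpace G] (n : Type*) [Fintype n]
    [DecidableEq n] (μ ρ : Measure G) (ν : ℕ → Measure G) (Ψ : G → Matrix n n ℂ) (R S : ℝ) :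
    Prop where
  meas : StronglyMeasurable Ψ
  herm : ∀ g, (Ψ g).IsHermitian
  bound : ∀ g, ‖Ψ g‖ ≤ R
  mean : ∫ g, Ψ g ∂μ = 0
  inv : ρ.map (fun y => y⁻¹) = ρ
  conj : ∀ z : G, ρ.map (fun y => z * y * z⁻¹) = ρ
  zero : ν 0 = Measure.dirac 1
  succ : ∀ i, ν (i + 1) = (ρ.prod (ν i)).map fun p => p.1 * p.2
  pos : 0 < S
  variance : ∀ g v, ∫ y, ‖act (Ψ g - Ψ (y * g)) v‖ ^ 2 ∂ρ ≤ S ^ 2 * ‖v‖ ^ 2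

/-! ### Averages along the walk and the approximate Poisson equation -/

namespace WalkData

variable {G : Type*} [Group G] [MeasurableSpace G] [MeasurableMul₂ G] [MeasurableInv G]
  {n : Type*} [Fintype n] [DecidableEq n] {μ ρ : Measure G} [IsProbabilityMeasure μ]
  [μ.IsMulLeftInvariant] [IsProbabilityMeasure ρ] {ν : ℕ → Measure G}
  [∀ i, IsProbabilityMeasure (ν i)] {Ψ : G → Matrix n n ℂ} {R S : ℝ}

theorem bound_nonneg (h : WalkData n μ ρ ν Ψ R S) : 0 ≤ R := (norm_nonneg _).trans (h.bound 1)

/-- The mean of `Ψ` under the walk started at `z`. -/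
noncomputable def avg (ν : ℕ → Measure G) (Ψ : G → Matrix n n ℂ) (i : ℕ) (z : G) :
    Matrix n n ℂ :=
  ∫ x, Ψ (x * z) ∂ν i

/-- The weight of the `i`-th step in the variance proxy. -/
noncomputable def weight (μ : Measure G) (ν : ℕ → Measure G) (R S : ℝ) (i : ℕ) : ℝ :=
  min 1 (4 * R * S⁻¹ * tvDist (ν i) μ)

theorem weight_nonneg (h : WalkData n μ ρ ν Ψ R S) (i : ℕ) : 0 ≤ weight μ ν R S i := by
  have h1 := h.bound_nonneg
  have h2 := tvDist_nonneg (ν i) μ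
  have h3 := h.pos
  exact le_min zero_le_one (by positivity)

theorem stronglyMeasurable_mul (h : WalkData n μ ρ ν Ψ R S) :
    StronglyMeasurable fun p : G × G => Ψ (p.1 * p.2) :=
  h.meas.comp_measurable (measurable_fst.mul measurable_snd)

theorem stronglyMeasurable_mul_right (h : WalkData n μ ρ ν Ψ R S) (z : G) :
    StronglyMeasurable fun x => Ψ (x * z) :=
  h.meas.comp_measurable (measurable_id.mul_const z)

theorem stronglyMeasurable_avg (h : WalkData n μ ρ ν Ψ R S) (i : ℕ) :
    StronglyMeasurable (avg ν Ψ i) :=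
  h.stronglyMeasurable_mul.integral_prod_left'

theorem isHermitian_avg (h : WalkData n μ ρ ν Ψ R S) (i : ℕ) (z : G) :
    (avg ν Ψ i z).IsHermitian :=
  isHermitian_integral fun _ => h.herm _

theorem norm_avg_le (h : WalkData n μ ρ ν Ψ R S) (i : ℕ) (z : G) : ‖avg ν Ψ i z‖ ≤ R := by
  refine (norm_integral_le_of_norm_le_const (Filter.Eventually.of_forall
    fun x => h.bound (x * z))).trans_eq ?_
  simp

/-- Right-invariance of `μ` makes `x ↦ Ψ (x * z)` have `μ`-mean zero as well, so only the distance
from `ν i` to `μ` matters. -/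
theorem norm_avg_le_tvDist (h : WalkData n μ ρ ν Ψ R S) (i : ℕ) (z : G) :
    ‖avg ν Ψ i z‖ ≤ 2 * R * tvDist (ν i) μ := by
  have := isMulRightInvariant_of_isProbabilityMeasure μ
  refine norm_integral_le_tvDist (h.stronglyMeasurable_mul_right z) (fun _ => h.herm _)
    h.bound_nonneg (fun _ => h.bound _) ?_
  rw [integral_mul_right_eq_self Ψ z, h.mean]

theorem avg_zero (h : WalkData n μ ρ ν Ψ R S) (z : G) : avg ν Ψ 0 z = Ψ z := by
  rw [avg, h.zero, integral_dirac' _ _ (h.stronglyMeasurable_mul_right z), one_mul]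

theorem integral_conj {E : Type*} [NormedAddCommGroup E] [NormedSpace ℝ E]
    (h : WalkData n μ ρ ν Ψ R S) {f : G → E} (hf : StronglyMeasurable f) (x : G) :
    ∫ y, f (x * y * x⁻¹) ∂ρ = ∫ y, f y ∂ρ := by
  have hm : Measurable fun y : G => x * y * x⁻¹ := (measurable_id.const_mul x).mul_const x⁻¹
  conv_rhs => rw [← h.conj x]
  rw [integral_map hm.aemeasurable hf.aestronglyMeasurable]

/-- The definition puts the extra step next to `z`, whereas the walk gains its new step on the far
left. Conjugation invariance moves it across, since `x y = (x y x⁻¹) x`. -/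
theorem integral_avg (h : WalkData n μ ρ ν Ψ R S) (i : ℕ) (z : G) :
    ∫ y, avg ν Ψ i (y * z) ∂ρ = avg ν Ψ (i + 1) z := by
  have hm : StronglyMeasurable fun p : G × G => Ψ (p.2 * (p.1 * z)) :=
    h.meas.comp_measurable (measurable_snd.mul (measurable_fst.mul_const z))
  have hm' : StronglyMeasurable fun p : G × G => Ψ (p.1 * p.2 * z) :=
    h.meas.comp_measurable ((measurable_fst.mul measurable_snd).mul_const z)
  have hmul : Measurable fun p : G × G => p.1 * p.2 := measurable_fst.mul measurable_snd
  unfold avg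
  rw [integral_integral_swap (f := fun y x => Ψ (x * (y * z)))
      (integrable_of_bounded hm fun _ => h.bound _), h.succ,
    integral_map hmul.aemeasurable
      (h.stronglyMeasurable_mul_right z).aestronglyMeasurable,
    integral_prod_symm _ (integrable_of_bounded hm' fun _ => h.bound _)]
  refine integral_congr_ae (Filter.Eventually.of_forall fun x => ?_)
  dsimp only
  rw [← h.integral_conj (f := fun y => Ψ (y * x * z))
    (h.meas.comp_measurable ((measurable_id.mul_const x).mul_const z)) x]
  simp [mul_assoc]

/-- Jensen's inequality moves the average over the walk outside the square. Since `x y z = (x y x⁻¹)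
(x z)`, conjugation invariance leaves the variance bound for `Ψ` at the point `x z`. -/
theorem integral_norm_avg_sub_sq_le_variance (h : WalkData n μ ρ ν Ψ R S) (i : ℕ) (z : G)
    (v : EuclideanSpace ℂ n) :
    ∫ y, ‖act (avg ν Ψ i z - avg ν Ψ i (y * z)) v‖ ^ 2 ∂ρ ≤ S ^ 2 * ‖v‖ ^ 2 := by
  let D : G × G → Matrix n n ℂ := fun p => Ψ (p.2 * z) - Ψ (p.2 * (p.1 * z))
  have hD : StronglyMeasurable D :=
    (h.meas.comp_measurable (measurable_snd.mul_const z)).sub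
      (h.meas.comp_measurable (measurable_snd.mul (measurable_fst.mul_const z)))
  have hDb : ∀ p, ‖D p‖ ≤ R + R := fun p =>
    (norm_sub_le _ _).trans (add_le_add (h.bound _) (h.bound _))
  have hc1 : Continuous fun A : Matrix n n ℂ => ‖act A v‖ := (actCLM v).continuous.norm
  have hc2 : Continuous fun A : Matrix n n ℂ => ‖act A v‖ ^ 2 := hc1.pow 2
  have hDy : ∀ y, StronglyMeasurable fun x => D (y, x) := fun y =>
    hD.comp_measurable measurable_prodMk_left
  have hint : Integrable (fun p => ‖act (D p) v‖ ^ 2) (ρ.prod (ν i)) :=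
    integrable_comp_of_bounded hD hDb hc2
  have hpt : ∀ y, ‖act (avg ν Ψ i z - avg ν Ψ i (y * z)) v‖ ^ 2 ≤
      ∫ x, ‖act (D (y, x)) v‖ ^ 2 ∂ν i := fun y => by
    have e : act (avg ν Ψ i z - avg ν Ψ i (y * z)) v = ∫ x, act (D (y, x)) v ∂ν i := by
      have e1 := (actCLM v).integral_comp_comm
        (integrable_of_bounded (P := ν i) (hDy y) fun x => hDb (y, x))
      simp only [actCLM_apply] at e1
      rw [e1, avg, avg, ← integral_sub
        (integrable_of_bounded (h.stronglyMeasurable_mul_right z) fun _ => h.bound _)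
        (integrable_of_bounded (h.stronglyMeasurable_mul_right _) fun _ => h.bound _)]
    rw [e]
    exact norm_integral_sq_le (integrable_comp_of_bounded (hDy y) (fun x => hDb (y, x)) hc1)
      (integrable_comp_of_bounded (hDy y) (fun x => hDb (y, x)) hc2)
  calc ∫ y, ‖act (avg ν Ψ i z - avg ν Ψ i (y * z)) v‖ ^ 2 ∂ρ
      ≤ ∫ y, ∫ x, ‖act (D (y, x)) v‖ ^ 2 ∂ν i ∂ρ :=
        integral_mono_of_nonneg (Filter.Eventually.of_forall fun y => by positivity)
          hint.integral_prod_left (Filter.Eventually.of_forall hpt)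
    _ = ∫ x, ∫ y, ‖act (D (y, x)) v‖ ^ 2 ∂ρ ∂ν i := integral_integral_swap hint
    _ ≤ ∫ _x, S ^ 2 * ‖v‖ ^ 2 ∂ν i := by
        refine integral_mono hint.integral_prod_right (integrable_const _) fun x => ?_
        refine le_trans (le_of_eq ?_) (h.variance (x * z) v)
        have hm : StronglyMeasurable fun y => Ψ (x * z) - Ψ (y * (x * z)) :=
          stronglyMeasurable_const.sub (h.stronglyMeasurable_mul_right (x * z))
        rw [← h.integral_conj (hc2.comp_stronglyMeasurable hm) x]
        simp [D, mul_assoc]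
    _ = _ := by simp

theorem norm_act_avg_sub_le (h : WalkData n μ ρ ν Ψ R S) (i : ℕ) (z z' : G)
    (v : EuclideanSpace ℂ n) :
    ‖act (avg ν Ψ i z - avg ν Ψ i z') v‖ ≤ 4 * R * tvDist (ν i) μ * ‖v‖ := by
  refine (norm_act_le _ _).trans (mul_le_mul_of_nonneg_right ?_ (norm_nonneg _))
  refine (norm_sub_le _ _).trans ?_
  have h1 := h.norm_avg_le_tvDist i z
  have h2 := h.norm_avg_le_tvDist i z'
  linarith

theorem integral_norm_avg_sub_sq_le (h : WalkData n μ ρ ν Ψ R S) (i : ℕ) (z : G)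
    (v : EuclideanSpace ℂ n) :
    ∫ y, ‖act (avg ν Ψ i z - avg ν Ψ i (y * z)) v‖ ^ 2 ∂ρ
      ≤ weight μ ν R S i ^ 2 * (S ^ 2 * ‖v‖ ^ 2) := by
  rcases min_choice 1 (4 * R * S⁻¹ * tvDist (ν i) μ) with hw | hw
  · rw [weight, hw, one_pow, one_mul]
    exact h.integral_norm_avg_sub_sq_le_variance i z v
  · have hS := h.pos.ne'
    have e : weight μ ν R S i ^ 2 * (S ^ 2 * ‖v‖ ^ 2) = (4 * R * tvDist (ν i) μ * ‖v‖) ^ 2 := by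
      rw [weight, hw]
      field_simp
    rw [e]
    calc _ ≤ ∫ _y, (4 * R * tvDist (ν i) μ * ‖v‖) ^ 2 ∂ρ :=
          integral_mono_of_nonneg (Filter.Eventually.of_forall fun y => by positivity)
            (integrable_const _) (Filter.Eventually.of_forall fun y =>
              pow_le_pow_left₀ (norm_nonneg _) (h.norm_act_avg_sub_le i z _ v) 2)
      _ = _ := by simp

/-- Covers the degenerate weights in the weighted Cauchy–Schwarz inequality, where division by zero
returns zero. -/
theorem act_avg_sub_eq_zero (h : WalkData n μ ρ ν Ψ R S) {i : ℕ} (hi : weight μ ν R S i = 0)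
    (z z' : G) (v : EuclideanSpace ℂ n) : act (avg ν Ψ i z - avg ν Ψ i z') v = 0 := by
  have hS := h.pos
  have h0 : 4 * R * S⁻¹ * tvDist (ν i) μ = 0 := by
    rcases min_choice 1 (4 * R * S⁻¹ * tvDist (ν i) μ) with hw | hw
    · rw [weight, hw] at hi
      exact absurd hi one_ne_zero
    · rwa [weight, hw] at hi
  have h1 : 4 * R * tvDist (ν i) μ = 0 := by
    have : 4 * R * tvDist (ν i) μ = S * (4 * R * S⁻¹ * tvDist (ν i) μ) := by field_simp
    rw [this, h0, mul_zero]
  have h2 := h.norm_act_avg_sub_le i z z' v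
  rw [h1, zero_mul] at h2
  exact norm_le_zero_iff.1 h2

/-- The potential whose increments form the kernel coupling. -/
noncomputable def potential (ν : ℕ → Measure G) (Ψ : G → Matrix n n ℂ) (k : ℕ) (z : G) :
    Matrix n n ℂ :=
  ∑ i ∈ Finset.range k, avg ν Ψ i z

theorem stronglyMeasurable_potential (h : WalkData n μ ρ ν Ψ R S) (k : ℕ) :
    StronglyMeasurable (potential ν Ψ k) :=
  Finset.stronglyMeasurable_fun_sum _ fun i _ => h.stronglyMeasurable_avg i

theorem isHermitian_potential (h : WalkData n μ ρ ν Ψ R S) (k : ℕ) (z : G) :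
    (potential ν Ψ k z).IsHermitian := by
  rw [potential, IsHermitian, conjTranspose_sum]
  exact Finset.sum_congr rfl fun i _ => h.isHermitian_avg i z

theorem norm_potential_le (h : WalkData n μ ρ ν Ψ R S) (k : ℕ) (z : G) :
    ‖potential ν Ψ k z‖ ≤ k * R := by
  refine (norm_sum_le_of_le _ fun i _ => h.norm_avg_le i z).trans_eq ?_
  simp

/-- Averaging over a step shifts the index of `avg`, so the sum telescopes. This is Poisson's
equation for the walk, with error `avg ν Ψ k`. -/
theorem potential_sub_integral (h : WalkData n μ ρ ν Ψ R S) (k : ℕ) (z : G) :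
    ∫ y, (potential ν Ψ k z - potential ν Ψ k (y * z)) ∂ρ = Ψ z - avg ν Ψ k z := by
  have hi : ∀ i, Integrable (fun y => avg ν Ψ i (y * z)) ρ := fun i =>
    integrable_of_bounded
      ((h.stronglyMeasurable_avg i).comp_measurable (measurable_id.mul_const z))
      fun _ => h.norm_avg_le i _
  unfold potential
  rw [integral_sub (integrable_const _) (integrable_finsetSum _ fun i _ => hi i),
    integral_finsetSum _ fun i _ => hi i]
  simp only [h.integral_avg, integral_const, probReal_univ, one_smul]
  rw [← Finset.sum_sub_distrib, Finset.sum_range_sub', h.avg_zero]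

theorem integral_norm_potential_sub_sq_le (h : WalkData n μ ρ ν Ψ R S) (k : ℕ) (z : G)
    (v : EuclideanSpace ℂ n) :
    ∫ y, ‖act (potential ν Ψ k z - potential ν Ψ k (y * z)) v‖ ^ 2 ∂ρ
      ≤ (∑ i ∈ Finset.range k, weight μ ν R S i) ^ 2 * (S ^ 2 * ‖v‖ ^ 2) := by
  set w := weight μ ν R S
  let a : ℕ → G → ℝ := fun i y => ‖act (avg ν Ψ i z - avg ν Ψ i (y * z)) v‖
  have hpt : ∀ y, ‖act (potential ν Ψ k z - potential ν Ψ k (y * z)) v‖ ^ 2 ≤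
      (∑ i ∈ Finset.range k, w i) * ∑ i ∈ Finset.range k, a i y ^ 2 / w i := fun y => by
    have e : act (potential ν Ψ k z - potential ν Ψ k (y * z)) v =
        ∑ i ∈ Finset.range k, act (avg ν Ψ i z - avg ν Ψ i (y * z)) v := by
      simp only [← actCLM_apply]
      rw [← map_sum, potential, potential, Finset.sum_sub_distrib]
    rw [e]
    refine (pow_le_pow_left₀ (norm_nonneg _) (norm_sum_le _ _) 2).trans ?_
    -- Cauchy–Schwarz with weights `w i`: as the `i`-th second moment is at most `w i ^ 2 * (S ^ 2 *
    -- ‖v‖ ^ 2)`, this choice produces the square of `∑ w i`, with no loss from the number of terms.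
    refine Finset.sum_sq_le_sum_mul_sum_of_sq_le_mul _ (fun i _ => h.weight_nonneg i)
      (fun i _ => div_nonneg (sq_nonneg _) (h.weight_nonneg i)) fun i _ => ?_
    by_cases hi : w i = 0
    · rw [h.act_avg_sub_eq_zero hi]
      simp [hi]
    · exact (mul_div_cancel₀ _ hi).ge
  have hint : ∀ i, Integrable (fun y => a i y ^ 2) ρ := fun i =>
    integrable_comp_of_bounded (X := fun y => avg ν Ψ i z - avg ν Ψ i (y * z)) (R := R + R)
      (stronglyMeasurable_const.sub
        ((h.stronglyMeasurable_avg i).comp_measurable (measurable_id.mul_const z)))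
      (fun y => (norm_sub_le _ _).trans (add_le_add (h.norm_avg_le i _) (h.norm_avg_le i _)))
      ((actCLM v).continuous.norm.pow 2)
  calc _ ≤ ∫ y, (∑ i ∈ Finset.range k, w i) * ∑ i ∈ Finset.range k, a i y ^ 2 / w i ∂ρ :=
        integral_mono_of_nonneg (Filter.Eventually.of_forall fun y => by positivity)
          ((integrable_finsetSum _ fun i _ => (hint i).div_const _).const_mul _)
          (Filter.Eventually.of_forall hpt)
    _ = (∑ i ∈ Finset.range k, w i) * ∑ i ∈ Finset.range k, (∫ y, a i y ^ 2 ∂ρ) / w i := by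
        rw [integral_const_mul, integral_finsetSum _ fun i _ => (hint i).div_const _]
        simp only [integral_div]
    _ ≤ (∑ i ∈ Finset.range k, w i) * ∑ i ∈ Finset.range k, w i * (S ^ 2 * ‖v‖ ^ 2) := by
        refine mul_le_mul_of_nonneg_left (Finset.sum_le_sum fun i _ => ?_)
          (Finset.sum_nonneg fun i _ => h.weight_nonneg i)
        refine div_le_of_le_mul₀ (h.weight_nonneg i)
          (mul_nonneg (h.weight_nonneg i) (by positivity)) ?_
        refine (h.integral_norm_avg_sub_sq_le i z v).trans_eq ?_
        ring
    _ = _ := by rw [← Finset.sum_mul]; ring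

end WalkData

/-! ### Traces against a matrix exponential -/

section Trace

variable {n : Type*} [Fintype n] [DecidableEq n]

theorem isHermitian_smul {A : Matrix n n ℂ} (hA : A.IsHermitian) (θ : ℝ) :
    (θ • A).IsHermitian := by
  rw [IsHermitian, conjTranspose_smul, hA.eq, star_trivial]

theorem continuous_exp : Continuous fun A : Matrix n n ℂ => NormedSpace.exp A :=
  letI : NormedAlgebra ℚ (Matrix n n ℂ) := NormedAlgebra.restrictScalars ℚ ℂ _
  NormedSpace.exp_continuous

theorem reTrace_exp_nonneg {A : Matrix n n ℂ} (hA : A.IsHermitian) :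
    0 ≤ reTrace (NormedSpace.exp A) := by
  rw [reTrace_apply, re_trace_exp hA]
  exact Finset.sum_nonneg fun i _ => (Real.exp_pos _).le

theorem reTrace_mul_exp_le {A M : Matrix n n ℂ} (hA : A.IsHermitian) :
    reTrace (M * NormedSpace.exp A) ≤ ‖M‖ * reTrace (NormedSpace.exp A) :=
  re_trace_mul_exp_le hA fun v hv => by
    have h := (le_abs_self _).trans (abs_quadCLM_le v M)
    rwa [hv, one_pow, mul_one, quadCLM_apply] at h

/-- The eigenbasis of `A` does not depend on the integration variable, so the second moment bound
applies to each eigenvector separately. -/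
theorem integral_reTrace_sq_mul_exp_le {α : Type*} [MeasurableSpace α] {P : Measure α}
    [IsProbabilityMeasure P] {A : Matrix n n ℂ} (hA : A.IsHermitian) {X : α → Matrix n n ℂ}
    (hX : StronglyMeasurable X) (hH : ∀ a, (X a).IsHermitian) {B : ℝ} (hB : ∀ a, ‖X a‖ ≤ B)
    {c : ℝ} (hc : ∀ v, ∫ a, ‖act (X a) v‖ ^ 2 ∂P ≤ c * ‖v‖ ^ 2) :
    ∫ a, reTrace (X a ^ 2 * NormedSpace.exp A) ∂P ≤ c * reTrace (NormedSpace.exp A) := by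
  simp only [reTrace_apply, re_trace_sq_mul_exp hA (hH _)]
  have hi : ∀ v, Integrable (fun a => ‖act (X a) v‖ ^ 2) P := fun v =>
    integrable_comp_of_bounded hX hB ((actCLM v).continuous.norm.pow 2)
  rw [re_trace_exp hA, integral_finsetSum _ fun i _ => (hi _).const_mul _, Finset.mul_sum]
  refine Finset.sum_le_sum fun i _ => ?_
  rw [integral_const_mul, mul_comm c]
  refine mul_le_mul_of_nonneg_left ?_ (Real.exp_pos _).le
  simpa using hc (hA.eigenvectorBasis i)

end Trace

/-! ### The differential inequality for the trace moment generating function -/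

namespace WalkData

variable {G : Type*} [Group G] [MeasurableSpace G] [MeasurableMul₂ G] [MeasurableInv G]
  {n : Type*} [Fintype n] [DecidableEq n] {μ ρ : Measure G} [IsProbabilityMeasure μ]
  [μ.IsMulLeftInvariant] [IsProbabilityMeasure ρ] {ν : ℕ → Measure G}
  [∀ i, IsProbabilityMeasure (ν i)] {Ψ : G → Matrix n n ℂ} {R S : ℝ}

/-- The trace moment generating function. -/
noncomputable def mgf (μ : Measure G) (Ψ : G → Matrix n n ℂ) (θ : ℝ) : ℝ :=
  ∫ z, reTrace (NormedSpace.exp (θ • Ψ z)) ∂μ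

theorem integrable_reTrace_exp (h : WalkData n μ ρ ν Ψ R S) (θ : ℝ) :
    Integrable (fun z => reTrace (NormedSpace.exp (θ • Ψ z))) μ :=
  integrable_comp_of_bounded h.meas h.bound
    (reTrace.continuous.comp (continuous_exp.comp (continuous_const_smul θ)))

theorem hasDerivAt_mgf (h : WalkData n μ ρ ν Ψ R S) (θ : ℝ) :
    HasDerivAt (mgf μ Ψ) (∫ z, reTrace (Ψ z * NormedSpace.exp (θ • Ψ z)) ∂μ) θ := by
  have hc : Continuous fun p : ℝ × Matrix n n ℂ => reTrace (p.2 * NormedSpace.exp (p.1 • p.2)) :=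
    reTrace.continuous.comp (continuous_snd.mul
      (continuous_exp.comp (continuous_fst.smul continuous_snd)))
  -- Joint continuity on a compact set gives one constant dominating the derivative for all
  -- parameters near `θ`.
  obtain ⟨C, hC⟩ := ((isCompact_closedBall θ 1).prod
    (isCompact_closedBall (0 : Matrix n n ℂ) R)).exists_bound_of_continuousOn hc.continuousOn
  refine (hasDerivAt_integral_of_dominated_loc_of_deriv_le (μ := μ) (bound := fun _ => C)
    (F := fun θ z => reTrace (NormedSpace.exp (θ • Ψ z)))
    (F' := fun θ z => reTrace (Ψ z * NormedSpace.exp (θ • Ψ z)))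
    (Metric.closedBall_mem_nhds θ one_pos)
    (Filter.Eventually.of_forall fun θ' => (h.integrable_reTrace_exp θ').aestronglyMeasurable)
    (h.integrable_reTrace_exp θ) ?_ ?_ (integrable_const C) ?_).2
  · exact (hc.comp_stronglyMeasurable
      (stronglyMeasurable_const.prodMk h.meas)).aestronglyMeasurable
  · exact Filter.Eventually.of_forall fun z θ' hθ' =>
      hC (θ', Ψ z) ⟨hθ', by simpa using h.bound z⟩
  · exact Filter.Eventually.of_forall fun z θ' _ =>
      (reTrace (n := n)).hasFDerivAt.comp_hasDerivAt θ' (hasDerivAt_exp_smul_const' (Ψ z) θ')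

/-- The exchangeable pairs bound, with the trace inequality applied to the increments of a
potential `H` along one step of the walk. -/
theorem integral_reTrace_increment_le (h : WalkData n μ ρ ν Ψ R S) {H : G → Matrix n n ℂ}
    (hH : StronglyMeasurable H) (hHh : ∀ z, (H z).IsHermitian) {B : ℝ} (hB : ∀ z, ‖H z‖ ≤ B)
    {c : ℝ} (hc : ∀ z v, ∫ y, ‖act (H z - H (y * z)) v‖ ^ 2 ∂ρ ≤ c * ‖v‖ ^ 2)
    {θ s : ℝ} (hs : 0 < s) :
    ∫ z, reTrace ((∫ y, (H z - H (y * z)) ∂ρ) * NormedSpace.exp (θ • Ψ z)) ∂μ ≤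
      (1 / 4) * (s * (θ ^ 2 * S ^ 2) + s⁻¹ * c) * mgf μ Ψ θ := by
  let X : G × G → Matrix n n ℂ × Matrix n n ℂ × Matrix n n ℂ × Matrix n n ℂ :=
    fun p => (H p.1, H (p.2 * p.1), Ψ p.1, Ψ (p.2 * p.1))
  have hmul : Measurable fun p : G × G => p.2 * p.1 := measurable_snd.mul measurable_fst
  have hX : StronglyMeasurable X :=
    (hH.comp_measurable measurable_fst).prodMk ((hH.comp_measurable hmul).prodMk
      ((h.meas.comp_measurable measurable_fst).prodMk (h.meas.comp_measurable hmul)))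
  have hXb : ∀ p, ‖X p‖ ≤ max B R := fun p => by
    simp only [X, Prod.norm_def]
    exact max_le ((hB _).trans (le_max_left _ _)) (max_le ((hB _).trans (le_max_left _ _))
      (max_le ((h.bound _).trans (le_max_right _ _)) ((h.bound _).trans (le_max_right _ _))))
  let T : G × G → ℝ := fun p =>
    reTrace ((H p.1 - H (p.2 * p.1)) * NormedSpace.exp (θ • Ψ p.1))
  let Q : G × G → ℝ := fun p =>
    reTrace ((θ • Ψ p.1 - θ • Ψ (p.2 * p.1)) ^ 2 * NormedSpace.exp (θ • Ψ p.1))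
  let V : G × G → ℝ := fun p =>
    reTrace ((H p.1 - H (p.2 * p.1)) ^ 2 * NormedSpace.exp (θ • Ψ p.1))
  have hT : Integrable T (μ.prod ρ) := integrable_comp_of_bounded hX hXb
    (f := fun q => reTrace ((q.1 - q.2.1) * NormedSpace.exp (θ • q.2.2.1)))
    (reTrace.continuous.comp ((by fun_prop : Continuous fun q : Matrix n n ℂ × Matrix n n ℂ ×
      Matrix n n ℂ × Matrix n n ℂ => q.1 - q.2.1).mul (continuous_exp.comp (by fun_prop))))
  have hQ : Integrable Q (μ.prod ρ) := integrable_comp_of_bounded hX hXb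
    (f := fun q => reTrace ((θ • q.2.2.1 - θ • q.2.2.2) ^ 2 * NormedSpace.exp (θ • q.2.2.1)))
    (reTrace.continuous.comp ((by fun_prop : Continuous fun q : Matrix n n ℂ × Matrix n n ℂ ×
      Matrix n n ℂ × Matrix n n ℂ => (θ • q.2.2.1 - θ • q.2.2.2) ^ 2).mul
        (continuous_exp.comp (by fun_prop))))
  have hV : Integrable V (μ.prod ρ) := integrable_comp_of_bounded hX hXb
    (f := fun q => reTrace ((q.1 - q.2.1) ^ 2 * NormedSpace.exp (θ • q.2.2.1)))
    (reTrace.continuous.comp ((by fun_prop : Continuous fun q : Matrix n n ℂ × Matrix n n ℂ ×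
      Matrix n n ℂ × Matrix n n ℂ => (q.1 - q.2.1) ^ 2).mul (continuous_exp.comp (by fun_prop))))
  -- In the coordinates `(z, y)`, this map interchanges `z` and `y z`: indeed `y⁻¹ (y z) = z`.
  let φ : G × G → G × G := fun p => (p.2 * p.1, p.2⁻¹)
  have hφ : MeasurePreserving φ (μ.prod ρ) (μ.prod ρ) := measurePreserving_exchange μ ρ h.inv
  have hcomp : ∀ {f : G × G → ℝ}, Integrable f (μ.prod ρ) →
      ∫ p, f (φ p) ∂μ.prod ρ = ∫ p, f p ∂μ.prod ρ := fun {f} hf => by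
    conv_rhs => rw [← hφ.map_eq]
    rw [integral_map hφ.measurable.aemeasurable (hφ.map_eq.symm ▸ hf.aestronglyMeasurable)]
  have hcompi : ∀ {f : G × G → ℝ}, Integrable f (μ.prod ρ) →
      Integrable (fun p => f (φ p)) (μ.prod ρ) := fun {f} hf => hφ.integrable_comp_of_integrable hf
  -- The increment of `H` changes sign under the interchange, so the two terms add up to the trace
  -- of that increment against a difference of exponentials. Integration then doubles both sides.
  have hpt : ∀ p, T p + T (φ p) ≤
      (1 / 4) * (s * (Q p + Q (φ p)) + s⁻¹ * (V p + V (φ p))) := fun p => by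
    have e := re_trace_mul_exp_sub_exp_le (isHermitian_smul (h.herm p.1) θ)
      (isHermitian_smul (h.herm (p.2 * p.1)) θ) ((hHh p.1).sub (hHh (p.2 * p.1))) hs
    have e1 : T (φ p) = -reTrace ((H p.1 - H (p.2 * p.1)) *
        NormedSpace.exp (θ • Ψ (p.2 * p.1))) := by
      simp only [T, φ, inv_mul_cancel_left]
      rw [← map_neg, ← neg_mul, neg_sub]
    have e2 : Q (φ p) = reTrace ((θ • Ψ p.1 - θ • Ψ (p.2 * p.1)) ^ 2 *
        NormedSpace.exp (θ • Ψ (p.2 * p.1))) := by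
      simp only [Q, φ, inv_mul_cancel_left]
      rw [← neg_sq, neg_sub]
    have e3 : V (φ p) = reTrace ((H p.1 - H (p.2 * p.1)) ^ 2 *
        NormedSpace.exp (θ • Ψ (p.2 * p.1))) := by
      simp only [V, φ, inv_mul_cancel_left]
      rw [← neg_sq, neg_sub]
    rw [e1, e2, e3, ← sub_eq_add_neg]
    exact e
  have hmain : ∫ p, T p ∂μ.prod ρ ≤
      (1 / 4) * (s * ∫ p, Q p ∂μ.prod ρ + s⁻¹ * ∫ p, V p ∂μ.prod ρ) := by
    have hQ2 : Integrable (fun p => Q p + Q (φ p)) (μ.prod ρ) := hQ.add (hcompi hQ)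
    have hV2 : Integrable (fun p => V p + V (φ p)) (μ.prod ρ) := hV.add (hcompi hV)
    have e := integral_mono (hT.add (hcompi hT))
      (((hQ2.const_mul s).add (hV2.const_mul s⁻¹)).const_mul (1 / 4)) hpt
    simp only [Pi.add_apply] at e
    rw [integral_add hT (hcompi hT), integral_const_mul,
      integral_add (hQ2.const_mul s) (hV2.const_mul s⁻¹),
      integral_const_mul, integral_const_mul, integral_add hQ (hcompi hQ),
      integral_add hV (hcompi hV), hcomp hT, hcomp hQ, hcomp hV] at e
    linarith
  have hHi : ∀ z, StronglyMeasurable fun y => H z - H (y * z) := fun z =>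
    stronglyMeasurable_const.sub (hH.comp_measurable (measurable_id.mul_const z))
  have hHb : ∀ z y, ‖H z - H (y * z)‖ ≤ B + B := fun z y =>
    (norm_sub_le _ _).trans (add_le_add (hB _) (hB _))
  have hQle : ∫ p, Q p ∂μ.prod ρ ≤ θ ^ 2 * S ^ 2 * mgf μ Ψ θ := by
    rw [integral_prod _ hQ, mgf, ← integral_const_mul]
    refine integral_mono hQ.integral_prod_left ((h.integrable_reTrace_exp θ).const_mul _)
      fun z => ?_
    refine integral_reTrace_sq_mul_exp_le (isHermitian_smul (h.herm z) θ)
      (X := fun y => θ • Ψ z - θ • Ψ (y * z)) (B := |θ| * R + |θ| * R)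
      (stronglyMeasurable_const.sub ((h.stronglyMeasurable_mul_right z).const_smul θ))
      (fun y => (isHermitian_smul (h.herm _) θ).sub (isHermitian_smul (h.herm _) θ))
      (fun y => (norm_sub_le _ _).trans (add_le_add ?_ ?_)) fun v => ?_
    · rw [norm_smul]
      exact mul_le_mul_of_nonneg_left (h.bound _) (norm_nonneg _)
    · rw [norm_smul]
      exact mul_le_mul_of_nonneg_left (h.bound _) (norm_nonneg _)
    · have e : ∀ y, ‖act (θ • Ψ z - θ • Ψ (y * z)) v‖ ^ 2 =
          θ ^ 2 * ‖act (Ψ z - Ψ (y * z)) v‖ ^ 2 := fun y => by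
        rw [← smul_sub, ← actCLM_apply, map_smul, norm_smul, mul_pow, Real.norm_eq_abs, sq_abs,
          actCLM_apply]
      simp only [e]
      rw [integral_const_mul, mul_assoc]
      exact mul_le_mul_of_nonneg_left (h.variance z v) (sq_nonneg θ)
  have hVle : ∫ p, V p ∂μ.prod ρ ≤ c * mgf μ Ψ θ := by
    rw [integral_prod _ hV, mgf, ← integral_const_mul]
    refine integral_mono hV.integral_prod_left ((h.integrable_reTrace_exp θ).const_mul _)
      fun z => ?_
    exact integral_reTrace_sq_mul_exp_le (isHermitian_smul (h.herm z) θ) (hHi z)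
      (fun y => (hHh _).sub (hHh _)) (hHb z) (hc z)
  have hTeq : ∫ z, reTrace ((∫ y, (H z - H (y * z)) ∂ρ) * NormedSpace.exp (θ • Ψ z)) ∂μ =
      ∫ p, T p ∂μ.prod ρ := by
    rw [integral_prod _ hT]
    refine integral_congr_ae (Filter.Eventually.of_forall fun z => ?_)
    let L : Matrix n n ℂ →L[ℝ] ℝ :=
      reTrace ∘L ((ContinuousLinearMap.mul ℝ (Matrix n n ℂ)).flip (NormedSpace.exp (θ • Ψ z)))
    exact (L.integral_comp_comm (integrable_of_bounded (P := ρ) (hHi z) (hHb z))).symm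
  rw [hTeq]
  have e1 := mul_le_mul_of_nonneg_left hQle hs.le
  have e2 := mul_le_mul_of_nonneg_left hVle (inv_pos.2 hs).le
  linarith

theorem integral_reTrace_sub_avg_le (h : WalkData n μ ρ ν Ψ R S) (k : ℕ) {s : ℝ} (hs : 0 < s)
    (hks : ∑ i ∈ Finset.range k, weight μ ν R S i ≤ s) {θ : ℝ} (hθ : 0 < θ) :
    ∫ z, reTrace ((Ψ z - avg ν Ψ k z) * NormedSpace.exp (θ • Ψ z)) ∂μ ≤
      θ * (S ^ 2 / 2 * s) * mgf μ Ψ θ := by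
  -- The parameter `s / θ` balances the two terms: each equals `θ * s * S ^ 2`.
  have h1 := h.integral_reTrace_increment_le (h.stronglyMeasurable_potential k)
    (h.isHermitian_potential k) (h.norm_potential_le k)
    (c := s ^ 2 * S ^ 2) (fun z v => (h.integral_norm_potential_sub_sq_le k z v).trans (by
      rw [mul_assoc]
      exact mul_le_mul_of_nonneg_right (pow_le_pow_left₀
        (Finset.sum_nonneg fun i _ => h.weight_nonneg i) hks 2) (by positivity)))
    (θ := θ) (s := s / θ) (div_pos hs hθ)
  simp only [h.potential_sub_integral] at h1
  refine h1.trans_eq ?_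
  field_simp
  ring

/-- A weight below 1 is attained by the total variation term, and `2 R TV = (S / 2) (4 R S⁻¹ TV)`.
-/
theorem norm_avg_le_weight (h : WalkData n μ ρ ν Ψ R S) {k : ℕ} (hk : weight μ ν R S k < 1)
    (z : G) : ‖avg ν Ψ k z‖ ≤ S / 2 * weight μ ν R S k := by
  have hS := h.pos.ne'
  refine (h.norm_avg_le_tvDist k z).trans_eq ?_
  rcases min_choice 1 (4 * R * S⁻¹ * tvDist (ν k) μ) with hw | hw
  · rw [weight, hw] at hk
    exact absurd hk (lt_irrefl _)
  · rw [weight, hw]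
    field_simp
    ring

theorem deriv_mgf_le_add (h : WalkData n μ ρ ν Ψ R S) {k : ℕ} (hk : weight μ ν R S k < 1)
    {s : ℝ} (hs : 0 < s) (hks : ∑ i ∈ Finset.range k, weight μ ν R S i ≤ s) {θ : ℝ}
    (hθ : 0 < θ) :
    ∫ z, reTrace (Ψ z * NormedSpace.exp (θ • Ψ z)) ∂μ ≤
      θ * (S ^ 2 / 2 * s) * mgf μ Ψ θ + S / 2 * weight μ ν R S k * mgf μ Ψ θ := by
  have hX : StronglyMeasurable fun z => (avg ν Ψ k z, Ψ z) :=
    (h.stronglyMeasurable_avg k).prodMk h.meas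
  have hXb : ∀ z, ‖(avg ν Ψ k z, Ψ z)‖ ≤ R := fun z => max_le (h.norm_avg_le k z) (h.bound z)
  have h1 : Integrable (fun z => reTrace ((Ψ z - avg ν Ψ k z) * NormedSpace.exp (θ • Ψ z))) μ :=
    integrable_comp_of_bounded hX hXb
      (f := fun q => reTrace ((q.2 - q.1) * NormedSpace.exp (θ • q.2)))
      (reTrace.continuous.comp ((continuous_snd.sub continuous_fst).mul
        (continuous_exp.comp (continuous_snd.const_smul θ))))
  have h2 : Integrable (fun z => reTrace (avg ν Ψ k z * NormedSpace.exp (θ • Ψ z))) μ :=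
    integrable_comp_of_bounded hX hXb
      (f := fun q => reTrace (q.1 * NormedSpace.exp (θ • q.2)))
      (reTrace.continuous.comp (continuous_fst.mul
        (continuous_exp.comp (continuous_snd.const_smul θ))))
  have e : ∀ z, reTrace (Ψ z * NormedSpace.exp (θ • Ψ z)) =
      reTrace ((Ψ z - avg ν Ψ k z) * NormedSpace.exp (θ • Ψ z)) +
        reTrace (avg ν Ψ k z * NormedSpace.exp (θ • Ψ z)) := fun z => by
    rw [← map_add, ← add_mul, sub_add_cancel]
  simp only [e]
  rw [integral_add h1 h2]
  refine add_le_add (h.integral_reTrace_sub_avg_le k hs hks hθ) ?_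
  rw [mgf, ← integral_const_mul]
  refine integral_mono h2 ((h.integrable_reTrace_exp θ).const_mul _) fun z => ?_
  have hH := isHermitian_smul (h.herm z) θ
  exact (reTrace_mul_exp_le hH).trans
    (mul_le_mul_of_nonneg_right (h.norm_avg_le_weight hk z) (reTrace_exp_nonneg hH))

open Filter Topology in
theorem deriv_mgf_le (h : WalkData n μ ρ ν Ψ R S) (hsum : Summable (weight μ ν R S))
    {θ : ℝ} (hθ : 0 < θ) :
    ∫ z, reTrace (Ψ z * NormedSpace.exp (θ • Ψ z)) ∂μ ≤
      θ * (S ^ 2 / 2 * ∑' i, weight μ ν R S i) * mgf μ Ψ θ := by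
  have hw := hsum.tendsto_atTop_zero
  have h0 : 0 ≤ ∑' i, weight μ ν R S i := tsum_nonneg h.weight_nonneg
  -- The slack `1 / (k + 1)` keeps the balancing parameter positive even if the partial sum of
  -- weights vanishes.
  have hlim : Tendsto (fun k : ℕ => θ * (S ^ 2 / 2 *
      (∑' i, weight μ ν R S i + 1 / ((k : ℝ) + 1))) * mgf μ Ψ θ +
        S / 2 * weight μ ν R S k * mgf μ Ψ θ) atTop
      (𝓝 (θ * (S ^ 2 / 2 * (∑' i, weight μ ν R S i + 0)) * mgf μ Ψ θ +
        S / 2 * 0 * mgf μ Ψ θ)) :=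
    ((((tendsto_one_div_add_atTop_nhds_zero_nat.const_add _).const_mul _).const_mul _).mul_const
      _).add ((hw.const_mul _).mul_const _)
  rw [mul_zero, zero_mul, add_zero, add_zero] at hlim
  refine ge_of_tendsto hlim ?_
  filter_upwards [hw.eventually_lt_const one_pos] with k hk
  have hk0 : (0 : ℝ) < 1 / ((k : ℝ) + 1) := by positivity
  refine h.deriv_mgf_le_add hk (by linarith) ?_ hθ
  have := hsum.sum_le_tsum (Finset.range k) fun i _ => h.weight_nonneg i
  linarith

theorem mgf_zero : mgf μ Ψ 0 = Fintype.card n := by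
  simp [mgf, Matrix.trace_one]

/-- The trace moment generating function is subgaussian. -/
theorem mgf_le (h : WalkData n μ ρ ν Ψ R S) (hsum : Summable (weight μ ν R S))
    {θ : ℝ} (hθ : 0 ≤ θ) :
    mgf μ Ψ θ ≤ Fintype.card n *
      Real.exp ((S ^ 2 / 2 * ∑' i, weight μ ν R S i) * θ ^ 2 / 2) := by
  set V := S ^ 2 / 2 * ∑' i, weight μ ν R S i with hV
  have hd : ∀ x : ℝ, HasDerivAt (fun x => mgf μ Ψ x * Real.exp (-(V * x ^ 2 / 2)))
      ((∫ z, reTrace (Ψ z * NormedSpace.exp (x • Ψ z)) ∂μ - x * V * mgf μ Ψ x) *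
        Real.exp (-(V * x ^ 2 / 2))) x := fun x => by
    have h1 : HasDerivAt (fun x : ℝ => -(V * x ^ 2 / 2)) (-(V * x)) x := by
      convert! ((((hasDerivAt_id x).pow 2).const_mul V).div_const 2).neg using 1
      simp
      ring
    convert! (h.hasDerivAt_mgf x).mul h1.exp using 1
    ring
  -- Grönwall's argument: by the differential inequality, multiplication by the integrating factor
  -- gives a decreasing function, which is then compared with its value at 0.
  have hanti : AntitoneOn (fun x => mgf μ Ψ x * Real.exp (-(V * x ^ 2 / 2))) (Set.Ici 0) := by
    refine antitoneOn_of_deriv_nonpos (convex_Ici 0)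
      (fun x _ => (hd x).continuousAt.continuousWithinAt)
      (fun x _ => (hd x).differentiableAt.differentiableWithinAt) fun x hx => ?_
    have hx0 : 0 < x := by simpa using hx
    rw [(hd x).deriv]
    exact mul_nonpos_of_nonpos_of_nonneg (sub_nonpos.2 (h.deriv_mgf_le hsum hx0))
      (Real.exp_pos _).le
  have h1 := hanti (Set.mem_Ici.2 le_rfl) (Set.mem_Ici.2 hθ) hθ
  simp only [mgf_zero] at h1
  rw [Real.exp_neg, ← div_eq_mul_inv, div_le_iff₀ (Real.exp_pos _)] at h1
  simpa using h1

end WalkData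

/-! ### Laws of the random walk -/

section Walk

variable {Ω G : Type*} [Group G] [MeasurableSpace Ω] [MeasurableSpace G] [MeasurableMul₂ G]
  {P : Measure Ω} {Y : ℕ → Ω → G}

theorem measurable_walk (hY : ∀ i, Measurable (Y i)) (i : ℕ) : Measurable (walk Y i) := by
  induction i with
  | zero => exact measurable_const
  | succ i ih => exact (hY (i + 1)).mul ih

/-- The walk at time `i` depends only on the variables of index at most `i`, which makes it
independent of the next step. -/
theorem measurable_walk_iSup (i : ℕ) :
    Measurable[⨆ j ∈ Set.Iic i, MeasurableSpace.comap (Y j) inferInstance] (walk Y i) := by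
  induction i with
  | zero => exact @measurable_const _ _ _ (_) _
  | succ i ih =>
    have h1 : Measurable[⨆ j ∈ Set.Iic (i + 1), MeasurableSpace.comap (Y j) inferInstance]
        (Y (i + 1)) :=
      (comap_measurable (Y (i + 1))).mono (le_iSup₂_of_le (i + 1) (Set.mem_Iic.2 le_rfl) le_rfl)
        le_rfl
    have h2 : Measurable[⨆ j ∈ Set.Iic (i + 1), MeasurableSpace.comap (Y j) inferInstance]
        (walk Y i) :=
      ih.mono (biSup_mono fun j hj => Set.mem_Iic.2 ((Set.mem_Iic.1 hj).trans i.le_succ)) le_rfl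
    exact @Measurable.mul _ _ _ _ _ (_) _ _ h1 h2

theorem indepFun_walk (hY : ∀ i, Measurable (Y i)) (hYindep : iIndepFun Y P) (i : ℕ) :
    IndepFun (Y (i + 1)) (walk Y i) P := by
  have h := indep_iSup_of_disjoint (fun j => (hY j).comap_le) hYindep.iIndep
    (S := {i + 1}) (T := Set.Iic i) (by simp)
  rw [IndepFun_iff_Indep]
  refine indep_of_indep_of_le_left (indep_of_indep_of_le_right h ?_) ?_
  · exact (measurable_walk_iSup i).comap_le
  · simp

theorem map_walk_succ [IsProbabilityMeasure P] (hY : ∀ i, Measurable (Y i))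
    (hYindep : iIndepFun Y P) (hYident : ∀ i, IdentDistrib (Y i) (Y 0) P P) (i : ℕ) :
    P.map (walk Y (i + 1)) =
      ((P.map (Y 0)).prod (P.map (walk Y i))).map fun p => p.1 * p.2 := by
  have hw := measurable_walk hY i
  have h := (indepFun_iff_map_prod_eq_prod_map_map (hY (i + 1)).aemeasurable
    hw.aemeasurable).1 (indepFun_walk hY hYindep i)
  rw [(hYident (i + 1)).map_eq] at h
  have hmul : Measurable fun p : G × G => p.1 * p.2 := measurable_fst.mul measurable_snd
  rw [← h, Measure.map_map hmul ((hY (i + 1)).prodMk hw)]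
  rfl

end Walk

/-! ### From random variables to their laws -/

section Setup

variable {G : Type*} [Group G] [MeasurableSpace G] [MeasurableMul₂ G] [MeasurableInv G]
  {μ : Measure G} {Ω : Type*} [MeasurableSpace Ω] {P : Measure Ω} [IsProbabilityMeasure P]
  {Z : Ω → G} {d : ℕ} {Ψ : G → Matrix (Fin d) (Fin d) ℂ} {Y : ℕ → Ω → G} {R S : ℝ}

theorem walkData_of_iIndepFun (hZ : Measurable Z) (hZlaw : P.map Z = μ)
    (hΨ : ∀ g, (Ψ g).IsHermitian) (hΨmeas : ∀ j k, Measurable fun g => Ψ g j k)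
    (hΨmean : expectation P (fun ω => Ψ (Z ω)) = 0)
    (hY : ∀ i, Measurable (Y i)) (hYindep : iIndepFun Y P)
    (hYident : ∀ i, IdentDistrib (Y i) (Y 0) P P)
    (hYinv : IdentDistrib (Y 0) (fun ω => (Y 0 ω)⁻¹) P P)
    (hYconj : ∀ z : G, IdentDistrib (fun ω => z * Y 0 ω * z⁻¹) (Y 0) P P)
    (hR : ∀ g, ‖Ψ g‖ ≤ R) (hSpos : 0 < S)
    (hS : ∀ g, ‖expectation P (fun ω => (Ψ g - Ψ (Y 0 ω * g)) ^ 2)‖ ≤ S ^ 2) :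
    WalkData (Fin d) μ (P.map (Y 0)) (fun i => P.map (walk Y i)) Ψ R S where
  meas := stronglyMeasurable_matrix hΨmeas
  herm := hΨ
  bound := hR
  mean := by
    have hm := stronglyMeasurable_matrix hΨmeas
    have hX : StronglyMeasurable fun ω => Ψ (Z ω) := hm.comp_measurable hZ
    rw [← hZlaw, integral_map hZ.aemeasurable hm.aestronglyMeasurable,
      ← expectation_eq_integral (integrable_of_bounded hX fun _ => hR _), hΨmean]
  inv := by
    rw [Measure.map_map measurable_inv (hY 0)]
    exact hYinv.map_eq.symm
  conj z := by
    have hz : Measurable fun y : G => z * y * z⁻¹ := (measurable_id.const_mul z).mul_const z⁻¹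
    rw [Measure.map_map hz (hY 0)]
    exact (hYconj z).map_eq
  zero := by
    change P.map (fun _ => 1) = _
    simp
  succ := map_walk_succ hY hYindep hYident
  pos := hSpos
  variance g v := by
    have hm := stronglyMeasurable_matrix hΨmeas
    have hD : StronglyMeasurable fun y => Ψ g - Ψ (y * g) :=
      stronglyMeasurable_const.sub (hm.comp_measurable (measurable_id.mul_const g))
    have hi : Integrable (fun ω => (Ψ g - Ψ (Y 0 ω * g)) ^ 2) P :=
      integrable_comp_of_bounded (X := fun ω => Ψ g - Ψ (Y 0 ω * g))
        (hD.comp_measurable (hY 0)) (R := R + R)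
        (fun ω => (norm_sub_le _ _).trans (add_le_add (hR _) (hR _))) (continuous_pow 2)
    have hc : Continuous fun A : Matrix (Fin d) (Fin d) ℂ => ‖act A v‖ ^ 2 :=
      (actCLM v).continuous.norm.pow 2
    rw [integral_map (hY 0).aemeasurable (hc.comp_stronglyMeasurable hD).aestronglyMeasurable]
    -- For a Hermitian increment `D`, `‖D v‖²` is the quadratic form of `D²` at `v`; it is linear in
    -- `D²`, so its mean is controlled by the norm of the expectation.
    simp only [← quadCLM_sq ((hΨ _).sub (hΨ _))]
    rw [(quadCLM v).integral_comp_comm hi, ← expectation_eq_integral hi]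
    exact ((le_abs_self _).trans (abs_quadCLM_le _ _)).trans
      (mul_le_mul_of_nonneg_right (hS g) (sq_nonneg _))

end Setup

/-! ### The matrix Laplace transform method -/

section LargestEigenvalue

variable {Ω : Type*} [MeasurableSpace Ω] {P : Measure Ω} [IsProbabilityMeasure P] {d : ℕ}
  {X : Ω → Matrix (Fin d) (Fin d) ℂ}

theorem measurable_lambdaMax (hd : 0 < d) (hX : StronglyMeasurable X)
    (hH : ∀ ω, (X ω).IsHermitian) : Measurable fun ω => lambdaMax (hH ω) := by
  refine measurable_of_tendsto_metrizable (f := fun (k : ℕ) ω =>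
    Real.log (NormedSpace.exp (((k : ℝ) + 1) • X ω)).trace.re / ((k : ℝ) + 1)) (fun k => ?_)
    (tendsto_pi_nhds.2 fun ω => tendsto_log_re_trace_exp hd (hH ω))
  have hc : Continuous fun A : Matrix (Fin d) (Fin d) ℂ =>
      reTrace (NormedSpace.exp (((k : ℝ) + 1) • A)) :=
    reTrace.continuous.comp (continuous_exp.comp (continuous_const_smul _))
  exact (hc.comp_stronglyMeasurable hX).measurable.log.div_const _

theorem integrable_lambdaMax (hd : 0 < d) (hX : StronglyMeasurable X)
    (hH : ∀ ω, (X ω).IsHermitian) {R : ℝ} (hR : ∀ ω, ‖X ω‖ ≤ R) :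
    Integrable (fun ω => lambdaMax (hH ω)) P :=
  integrable_of_bounded (measurable_lambdaMax hd hX hH).stronglyMeasurable fun ω =>
    (abs_lambdaMax_le hd (hH ω)).trans (hR ω)

theorem integrable_reTrace_exp_smul (hX : StronglyMeasurable X) {R : ℝ} (hR : ∀ ω, ‖X ω‖ ≤ R)
    (θ : ℝ) : Integrable (fun ω => reTrace (NormedSpace.exp (θ • X ω))) P :=
  integrable_comp_of_bounded hX hR
    (reTrace.continuous.comp (continuous_exp.comp (continuous_const_smul θ)))

/-- The matrix Laplace transform method for tails. -/
theorem measureReal_le_lambdaMax_le (hd : 0 < d) (hX : StronglyMeasurable X)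
    (hH : ∀ ω, (X ω).IsHermitian) {R : ℝ} (hR : ∀ ω, ‖X ω‖ ≤ R) {V : ℝ} (hV : 0 < V)
    (hm : ∀ θ, 0 ≤ θ → ∫ ω, reTrace (NormedSpace.exp (θ • X ω)) ∂P ≤
      d * Real.exp (V * θ ^ 2 / 2)) {t : ℝ} (ht : 0 ≤ t) :
    P.real {ω | t ≤ lambdaMax (hH ω)} ≤ d * Real.exp (-(t ^ 2 / (2 * V))) := by
  -- The value `θ = t / V` minimises the exponent `V θ² / 2 - θ t`.
  have hθ : 0 ≤ t / V := by positivity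
  have h1 := mul_meas_ge_le_integral_of_nonneg (μ := P)
    (Filter.Eventually.of_forall fun ω => reTrace_exp_nonneg (isHermitian_smul (hH ω) (t / V)))
    (integrable_reTrace_exp_smul hX hR (t / V)) (Real.exp (t / V * t))
  have h2 : P.real {ω | t ≤ lambdaMax (hH ω)} ≤
      P.real {ω | Real.exp (t / V * t) ≤ reTrace (NormedSpace.exp ((t / V) • X ω))} :=
    measureReal_mono fun ω hω => (Real.exp_le_exp.2
      (mul_le_mul_of_nonneg_left hω hθ)).trans (exp_mul_lambdaMax_le hd (hH ω) _)
  have h3 := (mul_le_mul_of_nonneg_left h2 (Real.exp_pos (t / V * t)).le).trans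
    (h1.trans (hm _ hθ))
  rw [mul_comm, ← le_div_iff₀ (Real.exp_pos _), mul_div_assoc, ← Real.exp_sub] at h3
  refine h3.trans_eq ?_
  congr 2
  field_simp
  ring

/-- The matrix Laplace transform method for the expectation. -/
theorem integral_lambdaMax_le (hd : 1 < d) (hX : StronglyMeasurable X)
    (hH : ∀ ω, (X ω).IsHermitian) {R : ℝ} (hR : ∀ ω, ‖X ω‖ ≤ R) {V : ℝ} (hV : 0 < V)
    (hm : ∀ θ, 0 ≤ θ → ∫ ω, reTrace (NormedSpace.exp (θ • X ω)) ∂P ≤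
      d * Real.exp (V * θ ^ 2 / 2)) :
    ∫ ω, lambdaMax (hH ω) ∂P ≤ Real.sqrt V * Real.sqrt (2 * Real.log d) := by
  have hd0 : (0 : ℝ) < d := by exact_mod_cast zero_lt_one.trans hd
  have hlog : 0 < Real.log d := Real.log_pos (by exact_mod_cast hd)
  set L := Real.sqrt (2 * Real.log d) with hL
  have hL0 : 0 < L := Real.sqrt_pos.2 (by positivity)
  have hL2 : L ^ 2 = 2 * Real.log d := Real.sq_sqrt (by positivity)
  have hs0 : 0 < Real.sqrt V := Real.sqrt_pos.2 hV
  have hs2 : Real.sqrt V ^ 2 = V := Real.sq_sqrt hV.le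
  -- With this `θ` one has `V θ² / 2 = log d`, so the trace moment is at most `d²`.
  set θ := L / Real.sqrt V with hθdef
  have hθ : 0 < θ := div_pos hL0 hs0
  have hVθ : V * θ ^ 2 / 2 = Real.log d := by
    rw [hθdef, div_pow, hL2, hs2]
    field_simp
  have hmθ := hm θ hθ.le
  rw [hVθ, Real.exp_log hd0] at hmθ
  have hi := integrable_lambdaMax (P := P) (zero_lt_one.trans hd) hX hH hR
  -- The tangent line of `exp` at `2 log d` plays the role of Jensen's inequality for the logarithm:
  -- integrated, it gives `θ E λ_max ≤ 2 log d`.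
  have hpt : ∀ ω, 1 + θ * lambdaMax (hH ω) - 2 * Real.log d ≤
      (d * d : ℝ)⁻¹ * reTrace (NormedSpace.exp (θ • X ω)) := fun ω => by
    have h1 := Real.add_one_le_exp (θ * lambdaMax (hH ω) - 2 * Real.log d)
    have h2 := exp_mul_lambdaMax_le (zero_lt_one.trans hd) (hH ω) θ
    have h3 : Real.exp (θ * lambdaMax (hH ω) - 2 * Real.log d) =
        (d * d : ℝ)⁻¹ * Real.exp (θ * lambdaMax (hH ω)) := by
      rw [Real.exp_sub, two_mul, Real.exp_add, Real.exp_log hd0, div_eq_inv_mul]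
    have h4 : (d * d : ℝ)⁻¹ * Real.exp (θ * lambdaMax (hH ω)) ≤
        (d * d : ℝ)⁻¹ * reTrace (NormedSpace.exp (θ • X ω)) :=
      mul_le_mul_of_nonneg_left h2 (by positivity)
    linarith
  have h1 : Integrable (fun ω => 1 + θ * lambdaMax (hH ω)) P :=
    (integrable_const 1).add (hi.const_mul θ)
  have h5 := integral_mono (h1.sub (integrable_const _))
    ((integrable_reTrace_exp_smul hX hR θ).const_mul _) hpt
  simp only [Pi.sub_apply] at h5
  rw [integral_const_mul, integral_sub h1 (integrable_const _),
    integral_add (integrable_const _) (hi.const_mul θ), integral_const_mul] at h5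
  simp only [integral_const, probReal_univ, one_smul] at h5
  have h6 : (d * d : ℝ)⁻¹ * ∫ ω, reTrace (NormedSpace.exp (θ • X ω)) ∂P ≤ 1 := by
    rw [inv_mul_le_iff₀ (by positivity), mul_one]
    exact hmθ
  have h7 : θ * ∫ ω, lambdaMax (hH ω) ∂P ≤ L ^ 2 := by rw [hL2]; linarith
  have h8 : L ^ 2 = θ * (Real.sqrt V * L) := by
    rw [hθdef]
    field_simp
  rw [h8] at h7
  exact le_of_mul_le_mul_left h7 hθ

theorem lambdaMax_eq_reTrace {A : Matrix (Fin 1) (Fin 1) ℂ} (hA : A.IsHermitian) :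
    lambdaMax hA = reTrace A := by
  rw [reTrace_apply, hA.trace_eq_sum_eigenvalues, lambdaMax]
  simp

end LargestEigenvalue

end HaarConcentration

/-! ### The concentration theorem -/

theorem corollary12p3
    {G : Type*} [Group G] [TopologicalSpace G] [IsTopologicalGroup G] [CompactSpace G]
    -- any sigma-algebra for which the group operations are measurable: the Borel one when `G` is
    -- second countable, the Baire one in general
    [MeasurableSpace G] [MeasurableMul₂ G] [MeasurableInv G]
    (μ : Measure G) [μ.IsHaarMeasure] [IsProbabilityMeasure μ]
    {Ω : Type*} [MeasurableSpace Ω] (P : Measure Ω) [IsProbabilityMeasure P]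
    (Z : Ω → G) (hZ : Measurable Z) (hZlaw : P.map Z = μ)
    (d : ℕ) (hd : 0 < d)
    (Ψ : G → Matrix (Fin d) (Fin d) ℂ) (hΨ : ∀ g, (Ψ g).IsHermitian)
    (hΨmeas : ∀ j k, Measurable fun g => Ψ g j k)
    (hΨmean : HaarConcentration.expectation P (fun ω => Ψ (Z ω)) = 0)
    -- `Y 0` is the step `Y` of the statement, and `Y 1, Y 2, ...` are its independent copies
    (Y : ℕ → Ω → G) (hY : ∀ i, Measurable (Y i)) (hYindep : iIndepFun Y P)
    (hYident : ∀ i, IdentDistrib (Y i) (Y 0) P P)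
    (hYinv : IdentDistrib (Y 0) (fun ω => (Y 0 ω)⁻¹) P P)
    (hYconj : ∀ z : G, IdentDistrib (fun ω => z * Y 0 ω * z⁻¹) (Y 0) P P)
    (R : ℝ) (hR : ∀ g, ‖Ψ g‖ ≤ R)
    (S : ℝ) (hSpos : 0 < S)
    (hS : IsLUB (Set.range fun g : G =>
      ‖HaarConcentration.expectation P (fun ω => (Ψ g - Ψ (Y 0 ω * g)) ^ 2)‖) (S ^ 2))
    (σsq : ℝ≥0∞)
    (hσ : σsq = HaarConcentration.sigmaSq R S
      (fun i => HaarConcentration.tvDist (P.map (HaarConcentration.walk Y i)) μ)) :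
    (∀ t : ℝ, 0 ≤ t →
      P {ω | t ≤ HaarConcentration.lambdaMax (hΨ (Z ω))} ≤
        (d : ℝ≥0∞) * EReal.exp (-((ENNReal.ofReal (t ^ 2) / (2 * σsq) : ℝ≥0∞) : EReal))) ∧
    Integrable (fun ω => HaarConcentration.lambdaMax (hΨ (Z ω))) P ∧
    ((∫ ω, HaarConcentration.lambdaMax (hΨ (Z ω)) ∂P : ℝ) : EReal) ≤
      ((σsq ^ (1 / 2 : ℝ) * ENNReal.ofReal (Real.sqrt (2 * Real.log d)) : ℝ≥0∞) : EReal) := by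
  have hS' : ∀ g, ‖HaarConcentration.expectation P (fun ω => (Ψ g - Ψ (Y 0 ω * g)) ^ 2)‖ ≤ S ^ 2 :=
    fun g => hS.1 ⟨g, rfl⟩
  have hdata := HaarConcentration.walkData_of_iIndepFun hZ hZlaw hΨ hΨmeas hΨmean hY hYindep
    hYident hYinv hYconj hR hSpos hS'
  have : IsProbabilityMeasure (P.map (Y 0)) :=
    Measure.isProbabilityMeasure_map (hY 0).aemeasurable
  have : ∀ i, IsProbabilityMeasure (P.map (HaarConcentration.walk Y i)) := fun i =>
    Measure.isProbabilityMeasure_map (HaarConcentration.measurable_walk hY i).aemeasurable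
  have hX : StronglyMeasurable fun ω => Ψ (Z ω) := hdata.meas.comp_measurable hZ
  have hXb : ∀ ω, ‖Ψ (Z ω)‖ ≤ R := fun ω => hR _
  have hint := HaarConcentration.integrable_lambdaMax (P := P) hd hX (fun ω => hΨ (Z ω)) hXb
  set w := HaarConcentration.WalkData.weight μ (fun i => P.map (HaarConcentration.walk Y i)) R S
    with hw
  have hσw : σsq = ENNReal.ofReal (S ^ 2 / 2) * ∑' i, ENNReal.ofReal (w i) := hσ
  -- For `d = 1` the claimed bound is 0, even when `σ² = ∞`; the Laplace argument would take `θ = 0`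
  -- there. Linearity of the trace gives mean zero directly.
  have hone : d = 1 → ∫ ω, HaarConcentration.lambdaMax (hΨ (Z ω)) ∂P = 0 := by
    rintro rfl
    simp only [HaarConcentration.lambdaMax_eq_reTrace]
    have hi := HaarConcentration.integrable_of_bounded (P := P) hX hXb
    rw [HaarConcentration.reTrace.integral_comp_comm hi,
      ← HaarConcentration.expectation_eq_integral hi, hΨmean, map_zero]
  by_cases hsum : Summable w
  · set V := S ^ 2 / 2 * ∑' i, w i with hVdef
    -- If the weight of the walk at time 0 vanished, so would `Ψ`, and then `S ^ 2`, being the least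
    -- upper bound, would be at most 0. This gives `V > 0`, needed to divide by it.
    have hw0 : 0 < w 0 := by
      refine lt_of_le_of_ne (hdata.weight_nonneg 0) fun h0 => ?_
      have hz : ∀ z, Ψ z = 0 := fun z => by
        have h1 := hdata.norm_avg_le_weight (k := 0) (by rw [← hw, ← h0]; exact one_pos) z
        rw [hdata.avg_zero, ← hw, ← h0, mul_zero] at h1
        exact norm_le_zero_iff.1 h1
      have h2 : S ^ 2 ≤ 0 := hS.2 (by
        rintro _ ⟨g, rfl⟩
        simp only [hz, sub_zero, ne_eq, OfNat.ofNat_ne_zero, not_false_eq_true, zero_pow]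
        have h3 : HaarConcentration.expectation P
            (fun _ => (0 : Matrix (Fin d) (Fin d) ℂ)) = 0 := by
          rw [HaarConcentration.expectation_eq_integral (integrable_const _)]
          simp
        rw [h3, norm_zero])
      nlinarith
    have hV : 0 < V :=
      mul_pos (by positivity) (hsum.tsum_pos hdata.weight_nonneg 0 hw0)
    have hσV : σsq = ENNReal.ofReal V := by
      rw [hσw, ← ENNReal.ofReal_tsum_of_nonneg hdata.weight_nonneg hsum,
        ← ENNReal.ofReal_mul (by positivity)]
    have hm : ∀ θ, 0 ≤ θ → ∫ ω, HaarConcentration.reTrace (NormedSpace.exp (θ • Ψ (Z ω))) ∂P ≤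
        d * Real.exp (V * θ ^ 2 / 2) := fun θ hθ => by
      have h1 := hdata.mgf_le hsum hθ
      have h2 : HaarConcentration.WalkData.mgf μ Ψ θ =
          ∫ ω, HaarConcentration.reTrace (NormedSpace.exp (θ • Ψ (Z ω))) ∂P := by
        have h3 := (hdata.integrable_reTrace_exp θ).aestronglyMeasurable
        rw [← hZlaw] at h3
        rw [HaarConcentration.WalkData.mgf, ← hZlaw, integral_map hZ.aemeasurable h3]
      rwa [h2, Fintype.card_fin] at h1
    refine ⟨fun t ht => ?_, hint, ?_⟩
    · have h1 := HaarConcentration.measureReal_le_lambdaMax_le hd hX (fun ω => hΨ (Z ω)) hXb hV hm ht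
      have h2 : (ENNReal.ofReal (t ^ 2) / (2 * σsq) : ℝ≥0∞) =
          ENNReal.ofReal (t ^ 2 / (2 * V)) := by
        rw [hσV, ENNReal.ofReal_div_of_pos (by positivity), ENNReal.ofReal_mul zero_le_two]
        simp
      rw [h2, EReal.coe_ennreal_ofReal, max_eq_left (by positivity), ← EReal.coe_neg,
        EReal.exp_coe, ← ENNReal.ofReal_natCast d, ← ENNReal.ofReal_mul (by positivity),
        ← ofReal_measureReal]
      exact ENNReal.ofReal_le_ofReal h1
    · rcases (Nat.succ_le_of_lt hd).eq_or_lt with h1 | h1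
      · rw [hone h1.symm]
        exact EReal.coe_ennreal_nonneg _
      · have h2 := HaarConcentration.integral_lambdaMax_le h1 hX (fun ω => hΨ (Z ω)) hXb hV hm
        rw [hσV, ENNReal.ofReal_rpow_of_nonneg hV.le (by norm_num), ← Real.sqrt_eq_rpow,
          ← ENNReal.ofReal_mul (Real.sqrt_nonneg _), EReal.coe_ennreal_ofReal,
          max_eq_left (by positivity)]
        exact EReal.coe_le_coe_iff.2 h2
  -- Nonsummable weights force `σ² = ∞`: the tail bound becomes `d ≥ 1`, and for `d > 1` the
  -- expectation bound is infinite.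
  · have hσtop : σsq = ⊤ := by
      have h1 : ∑' i, ENNReal.ofReal (w i) = ⊤ := by
        by_contra h2
        refine hsum ((ENNReal.summable_toReal h2).congr fun i => ?_)
        exact ENNReal.toReal_ofReal (hdata.weight_nonneg i)
      rw [hσw, h1, ENNReal.mul_top]
      exact (ENNReal.ofReal_pos.2 (by positivity)).ne'
    refine ⟨fun t ht => ?_, hint, ?_⟩
    · rw [hσtop]
      have h1 : (1 : ℝ≥0∞) ≤ d := by exact_mod_cast hd
      simpa using prob_le_one.trans h1
    · rcases (Nat.succ_le_of_lt hd).eq_or_lt with h1 | h1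
      · rw [hone h1.symm]
        exact EReal.coe_ennreal_nonneg _
      · have h2 : 0 < Real.sqrt (2 * Real.log d) :=
          Real.sqrt_pos.2 (mul_pos two_pos (Real.log_pos (by exact_mod_cast h1)))
        rw [hσtop, ENNReal.top_rpow_of_pos (by norm_num),
          ENNReal.top_mul (ENNReal.ofReal_pos.2 h2).ne', EReal.coe_ennreal_top]
        exact le_top
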